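/- Let $d\in\mathbb{N}$ and let $\lambda^d$ be Lebesgue measure on $\mathbb{R}^d$. For a separable metric space $V$ with a finite Borel measure $\pi$ and a Borel family of $\sigma$-finite measures $\kappa(x,\cdot)$ on $V$, let $\Theta_\kappa$ be the measure $\Theta_\kappa(\mathrm{d}x\,\mathrm{d}y)=\kappa(x,\mathrm{d}y)\,\pi(\mathrm{d}x)$ on $E=V\times V$, put $(\overline\nabla\varphi)(x,y)=\varphi(y)-\varphi(x)$, $E'=E\setminus\{(x,x):x\in V\}$, and \[ \mathcal{X}_2=\Bigl\{\varphi\in L^\infty(V;\pi):\ \iint_{E'}|\overline\nabla\varphi|^2\,\mathrm{d}\Theta_\kappa<\infty\Bigr\}. \] We say that $(V,\pi,\kappa)$ has the \emph{density property} if for every $\varphi\in\mathcal{X}_2$ there is a sequence $(\varphi_n)_n$ of bounded Lipschitz functions on $V$ such that $\varphi_n\to\varphi$ in $L^1(V;\pi)$ and $\overline\nabla\varphi_n\to\overline\nabla\varphi$ in $L^2(E;\Theta_\kappa)$ as $n\to\infty$. Let $\nu:\mathbb{R}^d\setminus\{0\}\to[0,\infty)$ be the (measurable) density of a symmetric L\'evy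 measure, that is, $\int_{\mathbb{R}^d}(1\wedge|h|^2)\,\nu(h)\,\lambda^d(\mathrm{d}h)<\infty$ and $\nu(h)=\nu(-h)$ for all $h\neq 0$. Then: (1) (The space $\mathbb{R}^d$.) Let $\gamma\in L^1(\mathbb{R}^d;\lambda^d)\cap L^\infty(\mathbb{R}^d;\lambda^d)$ be such that for every ball $B\subset\mathbb{R}^d$ there is $c_B>0$ with $\gamma(x)\ge c_B$ for a.e. $x\in B$. Then the triple $(V,\pi,\kappa)$ with $V=\mathbb{R}^d$, $\pi(\mathrm{d}x)=\gamma(x)\,\lambda^d(\mathrm{d}x)$ and $\kappa(x,\mathrm{d}y)=\gamma(y)\,\nu(y-x)\,\lambda^d(\mathrm{d}y)$ has the density property. (2) (Bounded domains.) Let $\Omega\subset\mathbb{R}^d$ be a bounded open set with Lipschitz boundary (for instance a bounded Lipschitz domain). Then the triple $(V,\pi,\kappa)$ with $V=\Omega$ (with the Euclidean metric), $\pi=\lambda^d|_\Omega$ and $\kappa(x,\mathrm{d}y)=\nu(x-y)\,\lambda^d|_\Omega(\mathrm{d}y)$ has the density property. -/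

import Mathlib

open MeasureTheory ProbabilityTheory Filter Topology
open scoped ENNReal NNReal

namespace DensityProp

/-! ### The density property of a triple `(V, π, κ)` -/

section General

/-- The measure `Θ_κ(dx dy) = κ(x, dy) π(dx)` on the edge space `E = V × V`
(see `edgeMeasure_prod`). -/
noncomputable def edgeMeasure {V : Type*} [MeasurableSpace V] (π : Measure V) (κ : Kernel V V) :
    Measure (V × V) :=
  π ⊗ₘ κ

/-- The product formula `Θ_κ(A × B) = ∫_A κ(x, B) π(dx)`. -/
theorem edgeMeasure_prod {V : Type*} [MeasurableSpace V] (π : Measure V) [SFinite π]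
    (κ : Kernel V V) [IsSFiniteKernel κ] {A B : Set V}
    (hA : MeasurableSet A) (hB : MeasurableSet B) :
    edgeMeasure π κ (A ×ˢ B) = ∫⁻ x in A, κ x B ∂π :=
  Measure.compProd_apply_prod hA hB

/-- The graph gradient `(∇̄φ)(x, y) = φ(y) - φ(x)`. -/
def graphGrad {V : Type*} (φ : V → ℝ) : V × V → ℝ :=
  fun p => φ p.2 - φ p.1

/-- `φ ∈ 𝒳₂`: `φ ∈ L^∞(V; π)` and `∬_{E'} |∇̄φ|² dΘ_κ < ∞`, where `E'` is the edge space
without its diagonal. -/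
def MemX2 {V : Type*} [MeasurableSpace V] (π : Measure V) (κ : Kernel V V) (φ : V → ℝ) : Prop :=
  MemLp φ ∞ π ∧
    ∫⁻ p in {p : V × V | p.1 ≠ p.2}, ENNReal.ofReal (graphGrad φ p ^ 2) ∂(edgeMeasure π κ) < ∞

/-- `φ ∈ Lip_b(V)`: bounded and Lipschitz. -/
def IsBoundedLipschitz {V : Type*} [PseudoMetricSpace V] (φ : V → ℝ) : Prop :=
  (∃ K : ℝ≥0, LipschitzWith K φ) ∧ ∃ C : ℝ, ∀ x, |φ x| ≤ C

/-- The density property: every `φ ∈ 𝒳₂` is approximated by a sequence of bounded Lipschitz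
functions `φ_n` with `φ_n → φ` in `L¹(V; π)` and `∇̄φ_n → ∇̄φ` in `L²(E; Θ_κ)`. -/
def DensityProperty {V : Type*} [PseudoMetricSpace V] [MeasurableSpace V]
    (π : Measure V) (κ : Kernel V V) : Prop :=
  ∀ φ : V → ℝ, MemX2 π κ φ →
    ∃ φn : ℕ → V → ℝ, (∀ n, IsBoundedLipschitz (φn n)) ∧
      Tendsto (fun n => eLpNorm (φn n - φ) 1 π) atTop (𝓝 0) ∧
      Tendsto (fun n => eLpNorm (graphGrad (φn n) - graphGrad φ) 2 (edgeMeasure π κ))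
        atTop (𝓝 0)

end General

/-! ### Lévy densities, the reference measures and the kernels -/

section Levy

/-- `ν` is the density of a symmetric Lévy measure on `ℝ^d \ {0}` (the value `ν 0` plays no
role). -/
structure IsSymmetricLevyDensity {d : ℕ} (ν : EuclideanSpace ℝ (Fin d) → ℝ≥0) : Prop where
  measurable : Measurable ν
  lintegral_lt_top :
    ∫⁻ h, min 1 (ENNReal.ofReal (‖h‖ ^ 2)) * (ν h : ℝ≥0∞) < ∞
  symm : ∀ h, h ≠ 0 → ν h = ν (-h)

/-- The measure `π = γ λ^d` on `ℝ^d`. -/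
noncomputable def weightedMeasure {d : ℕ} (γ : EuclideanSpace ℝ (Fin d) → ℝ) :
    Measure (EuclideanSpace ℝ (Fin d)) :=
  volume.withDensity fun x => ENNReal.ofReal (γ x)

instance {d : ℕ} (γ : EuclideanSpace ℝ (Fin d) → ℝ) : SFinite (weightedMeasure γ) := by
  unfold weightedMeasure; infer_instance

/-- The kernel `κ(x, dy) = γ(y) ν(y - x) λ^d(dy) = ν(y - x) π(dy)` on `ℝ^d`
(see `weightedLevyKernel_apply`). -/
noncomputable def weightedLevyKernel {d : ℕ} (γ : EuclideanSpace ℝ (Fin d) → ℝ)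
    (ν : EuclideanSpace ℝ (Fin d) → ℝ≥0) :
    Kernel (EuclideanSpace ℝ (Fin d)) (EuclideanSpace ℝ (Fin d)) :=
  (Kernel.const _ (weightedMeasure γ)).withDensity fun x y => (ν (y - x) : ℝ≥0∞)

instance {d : ℕ} (γ : EuclideanSpace ℝ (Fin d) → ℝ) (ν : EuclideanSpace ℝ (Fin d) → ℝ≥0) :
    IsSFiniteKernel (weightedLevyKernel γ ν) := by
  unfold weightedLevyKernel; infer_instance

theorem weightedLevyKernel_apply {d : ℕ} {γ : EuclideanSpace ℝ (Fin d) → ℝ}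
    {ν : EuclideanSpace ℝ (Fin d) → ℝ≥0} (hγ : AEMeasurable γ) (hν : Measurable ν)
    (x : EuclideanSpace ℝ (Fin d)) :
    weightedLevyKernel γ ν x =
      volume.withDensity fun y => ENNReal.ofReal (γ y) * (ν (y - x) : ℝ≥0∞) := by
  rw [weightedLevyKernel, Kernel.withDensity_apply, Kernel.const_apply, weightedMeasure,
    ← withDensity_mul₀ hγ.ennreal_ofReal (by fun_prop)]
  · rfl
  · unfold Function.uncurry
    fun_prop

/-- The Lebesgue measure `λ^d|_Ω` as a measure on the space `Ω` (see `domainMeasure_apply`). -/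
noncomputable def domainMeasure {d : ℕ} (Ω : Set (EuclideanSpace ℝ (Fin d))) : Measure Ω :=
  (volume : Measure (EuclideanSpace ℝ (Fin d))).comap (↑)

theorem domainMeasure_apply {d : ℕ} {Ω : Set (EuclideanSpace ℝ (Fin d))} (hΩ : IsOpen Ω)
    (A : Set Ω) : domainMeasure Ω A = volume ((↑) '' A : Set (EuclideanSpace ℝ (Fin d))) :=
  comap_subtype_coe_apply hΩ.measurableSet volume A

instance {d : ℕ} (Ω : Set (EuclideanSpace ℝ (Fin d))) : SFinite (domainMeasure Ω) := by
  have : SigmaFinite (domainMeasure Ω) := by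
    refine ⟨⟨⟨fun n => (↑) ⁻¹' Metric.ball (0 : EuclideanSpace ℝ (Fin d)) n, fun _ => trivial,
      fun n => ?_, ?_⟩⟩⟩
    · have hm : MeasurableSet
          ((↑) ⁻¹' Metric.ball (0 : EuclideanSpace ℝ (Fin d)) n : Set Ω) :=
        measurable_subtype_coe Metric.isOpen_ball.measurableSet
      refine (Measure.comap_apply_le _ _ hm.nullMeasurableSet).trans_lt
        ((measure_mono (Set.image_preimage_subset _ _)).trans_lt measure_ball_lt_top)
    · rw [← Set.preimage_iUnion, Metric.iUnion_ball_nat, Set.preimage_univ]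
  infer_instance

/-- The kernel `κ(x, dy) = ν(x - y) λ^d|_Ω(dy)` on `Ω ⊆ ℝ^d` (see `domainLevyKernel_apply`). -/
noncomputable def domainLevyKernel {d : ℕ} (Ω : Set (EuclideanSpace ℝ (Fin d)))
    (ν : EuclideanSpace ℝ (Fin d) → ℝ≥0) : Kernel Ω Ω :=
  (Kernel.const Ω (domainMeasure Ω)).withDensity
    fun x y => (ν ((x : EuclideanSpace ℝ (Fin d)) - y) : ℝ≥0∞)

instance {d : ℕ} (Ω : Set (EuclideanSpace ℝ (Fin d))) (ν : EuclideanSpace ℝ (Fin d) → ℝ≥0) :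
    IsSFiniteKernel (domainLevyKernel Ω ν) := by
  unfold domainLevyKernel; infer_instance

theorem domainLevyKernel_apply {d : ℕ} (Ω : Set (EuclideanSpace ℝ (Fin d)))
    {ν : EuclideanSpace ℝ (Fin d) → ℝ≥0} (hν : Measurable ν) (x : Ω) :
    domainLevyKernel Ω ν x =
      (domainMeasure Ω).withDensity
        fun y => (ν ((x : EuclideanSpace ℝ (Fin d)) - y) : ℝ≥0∞) := by
  rw [domainLevyKernel, Kernel.withDensity_apply, Kernel.const_apply]
  unfold Function.uncurry
  fun_prop

/-- The boundary of `Ω` is Lipschitz: near each boundary point `z`, for some direction `e`, the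
set `Ω` is the strict epigraph, in direction `e`, of a Lipschitz function of the orthogonal
coordinates. -/
def HasLipschitzBoundary {d : ℕ} (Ω : Set (EuclideanSpace ℝ (Fin d))) : Prop :=
  ∀ z ∈ frontier Ω, ∃ r > (0 : ℝ), ∃ e : EuclideanSpace ℝ (Fin d), ‖e‖ = 1 ∧
    ∃ (K : ℝ≥0) (g : (ℝ ∙ e)ᗮ → ℝ), LipschitzWith K g ∧
      ∀ x ∈ Metric.ball z r, x ∈ Ω ↔ g ((ℝ ∙ e)ᗮ.orthogonalProjectionOnto x) < inner ℝ e x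

end Levy

end DensityProp

/-! Replace `φ` by a bounded measurable representative `u` and approximate it by averages of
translates, `v(x) = ∫ u(x + w) dP(w)`, with `P` a smooth probability density carried by a small ball
of shifts. A Lipschitz density makes `v` Lipschitz as soon as `u` is integrable. For the energy on a
set `D`, put `U(x, y) = 1_{D×D}(x, y) (u(y) - u(x)) √ν(y - x)`, an `L²` function on the product. A
diagonal shift `(w, w)` keeps `y - x`, hence the weight, so if every shift maps `D` into itself, the
weighted gradient of `v - u` on `D × D` is the average of `U(· + (w, w)) - U`. Jensen and continuity
of translations in `L²` make it small, whatever the singularity of `ν` (`exists_lipschitz_approx`).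

Cutoffs localise the problem. Multiplying by a Lipschitz cutoff keeps the energy finite because `u`
is bounded and `1 ∧ |h|²` is `ν`-integrable (`levyEnergy_mul_lt_top`). A function supported well
inside a ball sees the outside only through long jumps, whose `ν`-mass is finite
(`levyEnergy_restrict_le_of_support`); so on that ball the domain may be exchanged for any `D` that
agrees with it there (`lipschitzApproximable_of_support`).

On `ℝ^d` take `D = ℝ^d`: `γ` is comparable to Lebesgue measure on balls, and cutoffs on growing
balls recover `u` by dominated convergence. On a bounded Lipschitz `Ω`, finitely many balls suffice;
near the boundary `D` is an epigraph, pushed into itself by shifts close to its axis. -/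

namespace DensityProp

/-! ### Nonlocal energy: tails, localisation and cutoffs -/

section Energy

variable {d : ℕ}

/-- The nonlocal energy `∬ |f(y) - f(x)|² ν(y - x) π(dx) π(dy)`. -/
noncomputable def levyEnergy (ν : EuclideanSpace ℝ (Fin d) → ℝ≥0)
    (π : Measure (EuclideanSpace ℝ (Fin d))) (f : EuclideanSpace ℝ (Fin d) → ℝ) : ℝ≥0∞ :=
  ∫⁻ p, ‖graphGrad f p‖ₑ ^ 2 * (ν (p.2 - p.1) : ℝ≥0∞) ∂(π.prod π)

theorem measurable_graphGrad {V : Type*} [MeasurableSpace V] {f : V → ℝ} (hf : Measurable f) :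
    Measurable (graphGrad f) := by
  unfold graphGrad; fun_prop

theorem graphGrad_sub {V : Type*} (f g : V → ℝ) :
    graphGrad (f - g) = graphGrad f - graphGrad g := by
  ext p; simp only [graphGrad, Pi.sub_apply]; ring

theorem graphGrad_add {V : Type*} (f g : V → ℝ) :
    graphGrad (f + g) = graphGrad f + graphGrad g := by
  ext p; simp only [graphGrad, Pi.add_apply]; ring

theorem enorm_sq_eq_ofReal (a : ℝ) : ‖a‖ₑ ^ 2 = ENNReal.ofReal (a ^ 2) := by
  rw [← Real.enorm_of_nonneg (sq_nonneg a), enorm_pow]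

theorem enorm_add_sq_le (a b : ℝ) : ‖a + b‖ₑ ^ 2 ≤ 2 * ‖a‖ₑ ^ 2 + 2 * ‖b‖ₑ ^ 2 := by
  simp only [enorm_sq_eq_ofReal]
  rw [show (2 : ℝ≥0∞) = ENNReal.ofReal 2 by simp, ← ENNReal.ofReal_mul (by norm_num),
    ← ENNReal.ofReal_mul (by norm_num), ← ENNReal.ofReal_add (by positivity) (by positivity)]
  exact ENNReal.ofReal_le_ofReal (by nlinarith [sq_nonneg (a - b)])

theorem measurable_levyEnergy_integrand {ν : EuclideanSpace ℝ (Fin d) → ℝ≥0} (hν : Measurable ν)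
    {f : EuclideanSpace ℝ (Fin d) → ℝ} (hf : Measurable f) :
    Measurable fun p : EuclideanSpace ℝ (Fin d) × EuclideanSpace ℝ (Fin d) =>
      ‖graphGrad f p‖ₑ ^ 2 * (ν (p.2 - p.1) : ℝ≥0∞) := by
  have := measurable_graphGrad hf
  fun_prop

theorem levyEnergy_mono_measure {ν : EuclideanSpace ℝ (Fin d) → ℝ≥0}
    {π π' : Measure (EuclideanSpace ℝ (Fin d))} [SFinite π'] {C : ℝ≥0}
    (h : π ≤ C • π') (f : EuclideanSpace ℝ (Fin d) → ℝ) :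
    levyEnergy ν π f ≤ (C : ℝ≥0∞) ^ 2 * levyEnergy ν π' f := by
  unfold levyEnergy
  refine (lintegral_mono' (Measure.prod_mono h h) le_rfl).trans ?_
  rw [Measure.prod_smul_left, Measure.prod_smul_right, smul_smul, lintegral_smul_measure]
  rw [ENNReal.smul_def]
  simp [sq]

theorem levyEnergy_add_le {ν : EuclideanSpace ℝ (Fin d) → ℝ≥0} (hν : Measurable ν)
    {π : Measure (EuclideanSpace ℝ (Fin d))} {f g : EuclideanSpace ℝ (Fin d) → ℝ}
    (hf : Measurable f) :
    levyEnergy ν π (f + g) ≤ 2 * levyEnergy ν π f + 2 * levyEnergy ν π g := by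
  unfold levyEnergy
  rw [← lintegral_const_mul' _ _ (by simp), ← lintegral_const_mul' _ _ (by simp),
    ← lintegral_add_left ((measurable_levyEnergy_integrand hν hf).const_mul _)]
  refine lintegral_mono fun p => ?_
  rw [← mul_assoc, ← mul_assoc, ← add_mul, graphGrad_add]
  gcongr
  exact enorm_add_sq_le _ _

/-- Fubini and translation invariance decouple the position from the jump `h = y - x`. -/
theorem lintegral_prod_mul_sub (π : Measure (EuclideanSpace ℝ (Fin d))) [SFinite π]
    {a k : EuclideanSpace ℝ (Fin d) → ℝ≥0∞} (ha : Measurable a) (hk : Measurable k) :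
    ∫⁻ p, a p.1 * k (p.2 - p.1) ∂(π.prod volume) = (∫⁻ x, a x ∂π) * ∫⁻ h, k h := by
  rw [lintegral_prod _ (by fun_prop), ← lintegral_mul_const _ ha]
  refine lintegral_congr fun x => ?_
  dsimp only
  rw [lintegral_const_mul _ (by fun_prop), lintegral_sub_right_eq_self]

theorem lintegral_prod_mul_sub' (π : Measure (EuclideanSpace ℝ (Fin d))) [SFinite π]
    {a k : EuclideanSpace ℝ (Fin d) → ℝ≥0∞} (ha : Measurable a) (hk : Measurable k) :
    ∫⁻ p, a p.2 * k (p.2 - p.1) ∂(Measure.prod volume π) = (∫⁻ x, a x ∂π) * ∫⁻ h, k h := by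
  rw [lintegral_prod_symm _ (by fun_prop), ← lintegral_mul_const _ ha]
  refine lintegral_congr fun x => ?_
  dsimp only
  rw [lintegral_const_mul _ (by fun_prop), lintegral_sub_left_eq_self]

/-- For `|h| ≥ δ`, the factor `max 1 δ⁻²` lifts `1 ∧ |h|²` to at least `1`. -/
theorem IsSymmetricLevyDensity.tail_lt_top {ν : EuclideanSpace ℝ (Fin d) → ℝ≥0}
    (hν : IsSymmetricLevyDensity ν) {δ : ℝ} (hδ : 0 < δ) :
    ∫⁻ h, {h | δ ≤ ‖h‖}.indicator (fun h => (ν h : ℝ≥0∞)) h < ∞ := by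
  have hC : ENNReal.ofReal (max 1 (δ ^ 2)⁻¹) ≠ ∞ := by simp
  refine lt_of_le_of_lt ?_ ((lintegral_const_mul' _ _ hC).trans_lt
    (ENNReal.mul_lt_top hC.lt_top hν.lintegral_lt_top))
  refine lintegral_mono (Set.indicator_le' (fun h hh => ?_) (fun _ _ => zero_le))
  have hh : δ ≤ ‖h‖ := hh
  rw [← mul_assoc]
  refine le_mul_of_one_le_left zero_le ?_
  rw [mul_min, mul_one, ← ENNReal.ofReal_mul (by positivity)]
  refine le_min ?_ ?_
  · rw [← ENNReal.ofReal_one]; exact ENNReal.ofReal_le_ofReal (le_max_left _ _)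
  · rw [← ENNReal.ofReal_one]; refine ENNReal.ofReal_le_ofReal ?_
    calc (1 : ℝ) = (δ ^ 2)⁻¹ * δ ^ 2 := by field_simp
      _ ≤ max 1 (δ ^ 2)⁻¹ * ‖h‖ ^ 2 := by gcongr; exact le_max_right _ _

/-- Energy of a function supported in a ball, compared with the energy on a larger ball. -/
theorem levyEnergy_restrict_le_of_support {ν : EuclideanSpace ℝ (Fin d) → ℝ≥0}
    (hν : Measurable ν) {A : Set (EuclideanSpace ℝ (Fin d))} (hA : MeasurableSet A)
    {f : EuclideanSpace ℝ (Fin d) → ℝ} (hf : Measurable f) {z : EuclideanSpace ℝ (Fin d)}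
    {ρ r : ℝ} (hsupp : ∀ x, x ∉ Metric.ball z ρ → f x = 0) (hρ : ρ ≤ r) :
    levyEnergy ν (volume.restrict A) f ≤
      levyEnergy ν (volume.restrict (A ∩ Metric.ball z r)) f +
      2 * ((∫⁻ x in A ∩ Metric.ball z r, ‖f x‖ₑ ^ 2) *
        ∫⁻ h, {h | r - ρ ≤ ‖h‖}.indicator (fun h => (ν h : ℝ≥0∞)) h) := by
  set B := A ∩ Metric.ball z r with hB
  have hBm : MeasurableSet B := hA.inter measurableSet_ball
  set k : EuclideanSpace ℝ (Fin d) → ℝ≥0∞ :=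
    {h | r - ρ ≤ ‖h‖}.indicator (fun h => (ν h : ℝ≥0∞)) with hk
  have hkm : Measurable k := by
    refine Measurable.indicator (by fun_prop) ?_
    exact measurableSet_le measurable_const measurable_norm
  set a : EuclideanSpace ℝ (Fin d) → ℝ≥0∞ := B.indicator fun x => ‖f x‖ₑ ^ 2 with ha
  have ham : Measurable a := Measurable.indicator (by fun_prop) hBm
  have hg := measurable_levyEnergy_integrand hν hf
  set g : EuclideanSpace ℝ (Fin d) × EuclideanSpace ℝ (Fin d) → ℝ≥0∞ :=
    fun p => ‖graphGrad f p‖ₑ ^ 2 * (ν (p.2 - p.1) : ℝ≥0∞) with hgdef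
  -- If a pair leaves the ball of radius `r`, its gradient vanishes unless the other point lies in
  -- the ball of radius `ρ`. Then the jump is at least `r - ρ` and the gradient is, up to sign, the
  -- value at that inner point.
  have key : ∀ p, (A ×ˢ A).indicator g p ≤
      (B ×ˢ B).indicator g p + (a p.1 * k (p.2 - p.1) + a p.2 * k (p.2 - p.1)) := by
    rintro ⟨x, y⟩
    by_cases hp : (x, y) ∈ A ×ˢ A
    swap
    · rw [Set.indicator_of_notMem hp]; exact zero_le
    rw [Set.indicator_of_mem hp]
    obtain ⟨hx, hy⟩ : x ∈ A ∧ y ∈ A := hp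
    by_cases hxr : x ∈ Metric.ball z r <;> by_cases hyr : y ∈ Metric.ball z r
    · rw [Set.indicator_of_mem (show (x, y) ∈ B ×ˢ B from ⟨⟨hx, hxr⟩, hy, hyr⟩)]
      exact le_add_of_nonneg_right zero_le
    · have hfy : f y = 0 := hsupp y fun h => hyr (Metric.ball_subset_ball hρ h)
      by_cases hxρ : x ∈ Metric.ball z ρ
      · refine le_trans ?_ (le_add_left le_self_add)
        have : r - ρ ≤ ‖y - x‖ := by
          rw [← dist_eq_norm]
          have := dist_triangle y x z
          simp only [Metric.mem_ball, not_lt] at hyr hxρ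
          linarith
        simp only [ha, hk, hgdef]
        rw [Set.indicator_of_mem (show x ∈ B from ⟨hx, hxr⟩), Set.indicator_of_mem (show y - x ∈ {h | r - ρ ≤ ‖h‖} from this)]
        simp [graphGrad, hfy]
      · simp [hgdef, graphGrad, hfy, hsupp x hxρ]
    · have hfx : f x = 0 := hsupp x fun h => hxr (Metric.ball_subset_ball hρ h)
      by_cases hyρ : y ∈ Metric.ball z ρ
      · refine le_trans ?_ (le_add_left le_add_self)
        have : r - ρ ≤ ‖y - x‖ := by
          rw [← dist_eq_norm, dist_comm]
          have := dist_triangle x y z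
          simp only [Metric.mem_ball, not_lt] at hxr hyρ
          linarith
        simp only [ha, hk, hgdef]
        rw [Set.indicator_of_mem (show y ∈ B from ⟨hy, hyr⟩), Set.indicator_of_mem (show y - x ∈ {h | r - ρ ≤ ‖h‖} from this)]
        simp [graphGrad, hfx]
      · simp [hgdef, graphGrad, hfx, hsupp y hyρ]
    · have hfx : f x = 0 := hsupp x fun h => hxr (Metric.ball_subset_ball hρ h)
      have hfy : f y = 0 := hsupp y fun h => hyr (Metric.ball_subset_ball hρ h)
      simp [hgdef, graphGrad, hfx, hfy]
  have hE : ∀ S : Set (EuclideanSpace ℝ (Fin d)), MeasurableSet S →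
      levyEnergy ν (volume.restrict S) f =
        ∫⁻ p, (S ×ˢ S).indicator g p ∂(Measure.prod volume volume) := fun S hS => by
    rw [lintegral_indicator (hS.prod hS), ← Measure.prod_restrict]; rfl
  rw [hE A hA, hE B hBm]
  refine (lintegral_mono key).trans ?_
  rw [lintegral_add_left (hg.indicator (hBm.prod hBm)),
    lintegral_add_left (by fun_prop), lintegral_prod_mul_sub _ ham hkm,
    lintegral_prod_mul_sub' _ ham hkm, ← two_mul, ha, lintegral_indicator hBm]

/-- Discrete Leibniz rule: `∇̄(ψu)(x, y) = ψ(y) ∇̄u(x, y) + u(x) ∇̄ψ(x, y)`. -/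
theorem graphGrad_mul_enorm_sq_le {V : Type*} {ψ u : V → ℝ} {M : ℝ≥0} (hu : ∀ x, |u x| ≤ M)
    (hψ : ∀ x, |ψ x| ≤ 1) (p : V × V) :
    ‖graphGrad (ψ * u) p‖ₑ ^ 2 ≤
      2 * ‖graphGrad u p‖ₑ ^ 2 + 2 * ((M : ℝ≥0∞) ^ 2 * ‖graphGrad ψ p‖ₑ ^ 2) := by
  have : graphGrad (ψ * u) p = ψ p.2 * graphGrad u p + u p.1 * graphGrad ψ p := by
    simp only [graphGrad, Pi.mul_apply]; ring
  rw [this]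
  refine (enorm_add_sq_le _ _).trans ?_
  have h1 : ‖ψ p.2‖ₑ ≤ 1 := by
    rw [← ofReal_norm, ← ENNReal.ofReal_one]; exact ENNReal.ofReal_le_ofReal (hψ _)
  have h2 : ‖u p.1‖ₑ ≤ M := by
    rw [← ofReal_norm, ← ENNReal.ofReal_coe_nnreal]; exact ENNReal.ofReal_le_ofReal (hu _)
  rw [enorm_mul, enorm_mul, mul_pow, mul_pow]
  gcongr
  exact mul_le_of_le_one_left zero_le (pow_le_one₀ zero_le h1)

theorem graphGrad_enorm_sq_le_of_lipschitz {ψ : EuclideanSpace ℝ (Fin d) → ℝ} {K : ℝ≥0}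
    (hK : LipschitzWith K ψ) (h0 : ∀ x, 0 ≤ ψ x) (h1 : ∀ x, ψ x ≤ 1)
    (p : EuclideanSpace ℝ (Fin d) × EuclideanSpace ℝ (Fin d)) :
    ‖graphGrad ψ p‖ₑ ^ 2 ≤
      ENNReal.ofReal (max 1 (K ^ 2)) * min 1 (ENNReal.ofReal (‖p.2 - p.1‖ ^ 2)) := by
  rw [enorm_sq_eq_ofReal, mul_min, mul_one, ← ENNReal.ofReal_mul (by positivity)]
  refine le_min (ENNReal.ofReal_le_ofReal ((?_ : _ ≤ (1 : ℝ)).trans (le_max_left _ _)))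
    (ENNReal.ofReal_le_ofReal ?_)
  · have := h0 p.1; have := h0 p.2; have := h1 p.1; have := h1 p.2
    unfold graphGrad
    rw [← sq_abs, sq_le_one_iff₀ (abs_nonneg _), abs_le]
    constructor <;> linarith
  · have := hK.dist_le_mul p.2 p.1
    rw [Real.dist_eq, dist_eq_norm] at this
    calc graphGrad ψ p ^ 2 = |ψ p.2 - ψ p.1| ^ 2 := (sq_abs _).symm
      _ ≤ (K * ‖p.2 - p.1‖) ^ 2 := by gcongr
      _ ≤ _ := by rw [mul_pow]; gcongr; exact le_max_right _ _

theorem lintegral_min_mul_levy_lt_top {ν : EuclideanSpace ℝ (Fin d) → ℝ≥0}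
    (hν : IsSymmetricLevyDensity ν) {π : Measure (EuclideanSpace ℝ (Fin d))} [IsFiniteMeasure π]
    {C : ℝ≥0} (hπ : π ≤ C • volume) :
    ∫⁻ p, min 1 (ENNReal.ofReal (‖p.2 - p.1‖ ^ 2)) * (ν (p.2 - p.1) : ℝ≥0∞) ∂(π.prod π) < ∞ := by
  have hm := hν.measurable
  have := lintegral_prod_mul_sub π (a := fun _ => 1) measurable_const
    (k := fun h => min 1 (ENNReal.ofReal (‖h‖ ^ 2)) * (ν h : ℝ≥0∞)) (by fun_prop)
  simp only [one_mul, lintegral_const] at this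
  refine (lintegral_mono' (Measure.prod_mono le_rfl hπ) le_rfl).trans_lt ?_
  rw [Measure.prod_smul_right, lintegral_smul_measure, this, ENNReal.smul_def, smul_eq_mul]
  exact ENNReal.mul_lt_top ENNReal.coe_lt_top
    (ENNReal.mul_lt_top (measure_lt_top _ _) hν.lintegral_lt_top)

theorem levyEnergy_mul_lt_top {ν : EuclideanSpace ℝ (Fin d) → ℝ≥0}
    (hν : IsSymmetricLevyDensity ν) {π : Measure (EuclideanSpace ℝ (Fin d))} [IsFiniteMeasure π]
    {C : ℝ≥0} (hπ : π ≤ C • volume) {ψ u : EuclideanSpace ℝ (Fin d) → ℝ} {K M : ℝ≥0}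
    (hu : Measurable u) (huM : ∀ x, |u x| ≤ M) (hE : levyEnergy ν π u < ∞)
    (hK : LipschitzWith K ψ) (h0 : ∀ x, 0 ≤ ψ x) (h1 : ∀ x, ψ x ≤ 1) :
    levyEnergy ν π (ψ * u) < ∞ := by
  have hb : ∀ p, ‖graphGrad (ψ * u) p‖ₑ ^ 2 * (ν (p.2 - p.1) : ℝ≥0∞) ≤
      2 * (‖graphGrad u p‖ₑ ^ 2 * (ν (p.2 - p.1) : ℝ≥0∞)) +
      (2 * ((M : ℝ≥0∞) ^ 2 * ENNReal.ofReal (max 1 (K ^ 2)))) *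
        (min 1 (ENNReal.ofReal (‖p.2 - p.1‖ ^ 2)) * (ν (p.2 - p.1) : ℝ≥0∞)) := fun p => by
    have hψ : ∀ x, |ψ x| ≤ 1 := fun x => abs_le.2 ⟨by linarith [h0 x], h1 x⟩
    calc _ ≤ (2 * ‖graphGrad u p‖ₑ ^ 2 + 2 * ((M : ℝ≥0∞) ^ 2 * (ENNReal.ofReal (max 1 (K ^ 2)) *
          min 1 (ENNReal.ofReal (‖p.2 - p.1‖ ^ 2))))) * (ν (p.2 - p.1) : ℝ≥0∞) := by
          gcongr
          refine (graphGrad_mul_enorm_sq_le huM hψ p).trans ?_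
          gcongr
          exact graphGrad_enorm_sq_le_of_lipschitz hK h0 h1 p
      _ = _ := by ring
  refine (lintegral_mono hb).trans_lt ?_
  rw [lintegral_add_left ((measurable_levyEnergy_integrand hν.measurable hu).const_mul _),
    lintegral_const_mul' _ _ (by simp), lintegral_const_mul' _ _ (by finiteness)]
  exact ENNReal.add_lt_top.2 ⟨ENNReal.mul_lt_top (by simp) hE,
    ENNReal.mul_lt_top (by finiteness) (lintegral_min_mul_levy_lt_top hν hπ)⟩

end Energy

/-! ### Mollification by inward shifts -/

section Mollification

/-- Continuity of translations in `L^p`, over a general group because it serves both for `u` in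
`L¹(ℝ^d)` and for the weighted gradient in `L²(ℝ^d × ℝ^d)`. -/
theorem tendsto_eLpNorm_translate_sub {G : Type*} [NormedAddCommGroup G] [MeasurableSpace G]
    [BorelSpace G] [SecondCountableTopology G] [CompleteSpace G] {μ : Measure G}
    [IsLocallyFiniteMeasure μ] [μ.InnerRegularCompactLTTop] [μ.IsAddRightInvariant]
    {p : ℝ≥0∞} [Fact (1 ≤ p)] (hp : p ≠ ∞) {f : G → ℝ} (hf : MemLp f p μ) :
    Tendsto (fun c => eLpNorm ((fun x => f (x + c)) - f) p μ) (𝓝 0) (𝓝 0) := by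
  let g : G → C(G, G) := fun c => ⟨fun x => x + c, by fun_prop⟩
  have hg : Continuous g :=
    (ContinuousMap.curry ⟨fun q : G × G => q.2 + q.1, by fun_prop⟩).continuous
  have hm : ∀ c, MeasurePreserving (g c) μ μ := fun c => measurePreserving_add_right μ c
  have h1 := (Continuous.compMeasurePreservingLp (f := fun _ : G => hf.toLp f) (g := g)
    continuous_const hg hm hp).tendsto 0
  have h2 : Lp.compMeasurePreserving (g 0) (hm 0) (hf.toLp f) = hf.toLp f := by
    rw [Lp.toLp_compMeasurePreserving]
    congr 1
    ext x; simp [g]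
  rw [h2, tendsto_iff_edist_tendsto_0] at h1
  refine h1.congr fun c => ?_
  rw [Lp.toLp_compMeasurePreserving, Lp.edist_toLp_toLp]
  rfl

theorem eLpNorm_two_sq {α : Type*} [MeasurableSpace α] {μ : Measure α} (f : α → ℝ) :
    eLpNorm f 2 μ ^ 2 = ∫⁻ x, ‖f x‖ₑ ^ 2 ∂μ := by
  have := eLpNorm_nnreal_pow_eq_lintegral (μ := μ) (f := f) (p := 2) (by norm_num)
  simpa using this

theorem enorm_integral_sq_le {α : Type*} [MeasurableSpace α] {P : Measure α}
    [IsProbabilityMeasure P] {g : α → ℝ} (hg : AEStronglyMeasurable g P) :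
    ‖∫ w, g w ∂P‖ₑ ^ 2 ≤ ∫⁻ w, ‖g w‖ₑ ^ 2 ∂P := by
  rw [← eLpNorm_two_sq]
  gcongr
  refine (enorm_integral_le_lintegral_enorm _).trans ?_
  rw [← eLpNorm_one_eq_lintegral_enorm]
  exact eLpNorm_le_eLpNorm_of_exponent_le (by norm_num) hg

variable {d : ℕ}

/-- There are arbitrarily small open sets of translations which map `D` into itself. -/
def HasInwardShifts (D : Set (EuclideanSpace ℝ (Fin d))) : Prop :=
  ∀ η > (0 : ℝ), ∃ c, ∃ δ > (0 : ℝ), Metric.ball c δ ⊆ Metric.ball 0 η ∧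
    ∀ w ∈ Metric.ball c δ, ∀ x ∈ D, x + w ∈ D

/-- `P` is a normalised bump centred at `c`. Substituting `z = x + w` moves the dependence on `x`
onto the bump, so the Lipschitz constant is that of the bump times `‖u‖₁`. -/
theorem exists_lipschitz_mollifier (c : EuclideanSpace ℝ (Fin d)) {δ : ℝ} (hδ : 0 < δ) :
    ∃ P : Measure (EuclideanSpace ℝ (Fin d)), IsProbabilityMeasure P ∧
      (∀ᵐ w ∂P, w ∈ Metric.ball c δ) ∧
      ∀ u : EuclideanSpace ℝ (Fin d) → ℝ, Integrable u volume →
        ∃ K, LipschitzWith K fun x => ∫ w, u (x + w) ∂P := by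
  let b : ContDiffBump c := ⟨δ / 2, δ, by linarith, by linarith⟩
  let ρ : EuclideanSpace ℝ (Fin d) → ℝ := b.normed volume
  have hρc : Continuous ρ := b.continuous_normed
  have hρ0 : ∀ w, 0 ≤ ρ w := b.nonneg_normed
  obtain ⟨K, hK⟩ := ContDiff.lipschitzWith_of_hasCompactSupport (𝕂 := ℝ) (n := 1)
    b.hasCompactSupport_normed (b.contDiff_normed (μ := volume) (n := 1)) (by norm_num)
  have hm : Measurable fun w => ENNReal.ofReal (ρ w) := by fun_prop
  refine ⟨volume.withDensity fun w => ENNReal.ofReal (ρ w), ⟨?_⟩, ?_, fun u hu => ?_⟩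
  · rw [withDensity_apply _ MeasurableSet.univ, Measure.restrict_univ,
      ← ofReal_integral_eq_lintegral_ofReal b.integrable_normed (ae_of_all _ hρ0)]
    simp [b.integral_normed]
  · rw [ae_withDensity_iff hm]
    refine ae_of_all _ fun w hw => ?_
    have : w ∈ Function.support ρ := fun h => hw (by simp [h])
    rwa [b.support_normed_eq] at this
  · have hv : ∀ x, ∫ w, u (x + w) ∂(volume.withDensity fun w => ENNReal.ofReal (ρ w)) =
        ∫ z, ρ (z - x) * u z := fun x => by
      rw [integral_withDensity_eq_integral_toReal_smul hm (by simp),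
        ← integral_add_left_eq_self (μ := volume) (fun z => ρ (z - x) * u z) x]
      refine integral_congr_ae (ae_of_all _ fun w => ?_)
      simp [ENNReal.toReal_ofReal (hρ0 w)]
    obtain ⟨C, hC⟩ : ∃ C, ∀ w, ‖ρ w‖ ≤ C :=
      hρc.bounded_above_of_compact_support b.hasCompactSupport_normed
    have hint : ∀ x, Integrable (fun z => ρ (z - x) * u z) := fun x =>
      hu.bdd_mul (c := C) (by fun_prop) (ae_of_all _ fun z => hC _)
    refine ⟨K * (∫ z, ‖u z‖).toNNReal, LipschitzWith.of_dist_le_mul fun x y => ?_⟩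
    rw [hv, hv, Real.dist_eq, ← integral_sub (hint x) (hint y)]
    have hn : 0 ≤ ∫ z, ‖u z‖ := integral_nonneg fun _ => norm_nonneg _
    calc |∫ z, ρ (z - x) * u z - ρ (z - y) * u z|
        ≤ ∫ z, K * dist x y * ‖u z‖ := by
          rw [← Real.norm_eq_abs]
          refine norm_integral_le_of_norm_le (hu.norm.const_mul _) (ae_of_all _ fun z => ?_)
          rw [← sub_mul, norm_mul]
          gcongr
          have := hK.dist_le_mul (z - x) (z - y)
          rwa [dist_sub_left] at this
      _ = _ := by
          rw [integral_const_mul, NNReal.coe_mul, Real.coe_toNNReal _ hn]; ring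

/-- The inward mollification of a bounded integrable function of finite energy. -/
theorem exists_lipschitz_approx {ν : EuclideanSpace ℝ (Fin d) → ℝ≥0} (hν : Measurable ν)
    {D : Set (EuclideanSpace ℝ (Fin d))} (hD : MeasurableSet D) (hsh : HasInwardShifts D)
    {u : EuclideanSpace ℝ (Fin d) → ℝ} (hu : Measurable u) {M : ℝ≥0} (huM : ∀ x, |u x| ≤ M)
    (hui : Integrable u volume) (hE : levyEnergy ν (volume.restrict D) u < ∞)
    {ε : ℝ≥0∞} (hε : ε ≠ 0) {η : ℝ} (hη : 0 < η) :
    ∃ v : EuclideanSpace ℝ (Fin d) → ℝ, (∃ K, LipschitzWith K v) ∧ (∀ x, |v x| ≤ M) ∧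
      (∀ z ρ, (∀ x, x ∉ Metric.ball z ρ → u x = 0) →
        ∀ x, x ∉ Metric.ball z (ρ + η) → v x = 0) ∧
      ∫⁻ x, ‖v x - u x‖ₑ ≤ ε ∧ levyEnergy ν (volume.restrict D) (v - u) ≤ ε := by
  let U : EuclideanSpace ℝ (Fin d) × EuclideanSpace ℝ (Fin d) → ℝ :=
    (D ×ˢ D).indicator fun p => graphGrad u p * √(ν (p.2 - p.1))
  have hUm : Measurable U := by
    refine Measurable.indicator ?_ (hD.prod hD)
    have := measurable_graphGrad hu
    fun_prop
  have hsq : ∀ (a : ℝ) (b : ℝ≥0), ‖a * √b‖ₑ ^ 2 = ‖a‖ₑ ^ 2 * (b : ℝ≥0∞) := fun a b => by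
    rw [enorm_mul, mul_pow, enorm_sq_eq_ofReal (√b), Real.sq_sqrt b.coe_nonneg, ENNReal.ofReal_coe_nnreal]
  have hU2 : MemLp U 2 (Measure.prod volume volume) := by
    refine ⟨hUm.aestronglyMeasurable, ?_⟩
    have : eLpNorm U 2 (Measure.prod volume volume) ^ 2 =
        levyEnergy ν (volume.restrict D) u := by
      rw [eLpNorm_two_sq, levyEnergy, Measure.prod_restrict, ← lintegral_indicator (hD.prod hD)]
      refine lintegral_congr fun p => ?_
      by_cases hp : p ∈ D ×ˢ D
      · simp only [U, Set.indicator_of_mem hp, hsq]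
      · simp [U, Set.indicator_of_notMem hp]
    rw [← this] at hE
    simpa using hE
  -- The `L¹` bound needs `ε`; the `L²` norm is squared to give an energy, hence `ε ^ (1 / 2)`.
  have hpos : (0 : ℝ≥0∞) < min ε (ε ^ (1 / 2 : ℝ)) := by
    have := pos_iff_ne_zero.2 hε
    exact lt_min this (ENNReal.rpow_pos_of_nonneg this (by norm_num))
  have h1 := (tendsto_eLpNorm_translate_sub (p := 1) (by simp)
    (memLp_one_iff_integrable.2 hui)).eventually_le_const hpos
  have hdiag : Tendsto (fun w : EuclideanSpace ℝ (Fin d) => (w, w)) (𝓝 0) (𝓝 0) :=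
    Continuous.tendsto (f := fun w : EuclideanSpace ℝ (Fin d) => (w, w)) (by fun_prop) 0
  have h2 := hdiag.eventually
    ((tendsto_eLpNorm_translate_sub (by simp) hU2).eventually_le_const hpos)
  obtain ⟨η', hη', hball⟩ := Metric.eventually_nhds_iff_ball.1 (h1.and h2)
  -- Shifts below `η` control the growth of the support; those below `η'` control both translation
  -- errors.
  obtain ⟨c, δ, hδ, hsub, hDw⟩ := hsh (min η η') (lt_min hη hη')
  obtain ⟨P, hP, hPc, hPL⟩ := exists_lipschitz_mollifier c hδ
  have hshift : ∀ x, Measurable fun w => u (x + w) := fun x => by fun_prop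
  have hshift_int : ∀ x, Integrable (fun w => u (x + w)) P := fun x =>
    Integrable.of_bound (hshift x).aestronglyMeasurable M (ae_of_all _ fun w => huM _)
  have hdiff : ∀ x, (∫ w, u (x + w) ∂P) - u x = ∫ w, (u (x + w) - u x) ∂P := fun x => by
    rw [integral_sub (hshift_int x) (integrable_const _)]; simp
  refine ⟨fun x => ∫ w, u (x + w) ∂P, hPL u hui, fun x => ?_, fun z ρ hz x hx => ?_, ?_, ?_⟩
  · have := norm_integral_le_of_norm_le_const (μ := P) (f := fun w => u (x + w)) (C := M)
      (ae_of_all _ fun w => huM _)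
    simpa using this
  · refine integral_eq_zero_of_ae (hPc.mono fun w hw => hz _ fun h => hx ?_)
    have hw' : ‖w‖ < min η η' := by simpa using hsub hw
    have hw'' := hw'.trans_le (min_le_left _ _)
    rw [Metric.mem_ball, dist_eq_norm] at h ⊢
    calc ‖x - z‖ = ‖(x + w - z) - w‖ := by congr 1; abel
      _ ≤ ‖x + w - z‖ + ‖w‖ := norm_sub_le _ _
      _ < _ := by linarith
  · calc ∫⁻ x, ‖(∫ w, u (x + w) ∂P) - u x‖ₑ
        ≤ ∫⁻ x, ∫⁻ w, ‖u (x + w) - u x‖ₑ ∂P := by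
          refine lintegral_mono fun x => ?_
          rw [hdiff]
          exact enorm_integral_le_lintegral_enorm _
      _ = ∫⁻ w, ∫⁻ x, ‖u (x + w) - u x‖ₑ ∂volume ∂P := by
          rw [lintegral_lintegral_swap]
          exact Measurable.aemeasurable (by fun_prop)
      _ ≤ ∫⁻ w, ε ∂P := by
          refine lintegral_mono_ae (hPc.mono fun w hw => ?_)
          have := (hball w ((Metric.ball_subset_ball (min_le_right _ _)) (hsub hw))).1
          rw [eLpNorm_one_eq_lintegral_enorm] at this
          exact this.trans (min_le_left _ _)
      _ = ε := by simp
  · set v : EuclideanSpace ℝ (Fin d) → ℝ := fun x => ∫ w, u (x + w) ∂P with hv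
    -- A shift by `(w, w)` keeps `p` in `D ×ˢ D` and leaves `p.2 - p.1` unchanged, so the weight
    -- passes through the average; Jensen then bounds the square.
    have hpt : ∀ p ∈ D ×ˢ D, ‖graphGrad (v - u) p‖ₑ ^ 2 * (ν (p.2 - p.1) : ℝ≥0∞) ≤
        ∫⁻ w, ‖U (p + (w, w)) - U p‖ₑ ^ 2 ∂P := fun p hp => by
      have : graphGrad (v - u) p * √(ν (p.2 - p.1)) = ∫ w, (U (p + (w, w)) - U p) ∂P := by
        have e1 : graphGrad (v - u) p =
            ∫ w, ((u (p.2 + w) - u p.2) - (u (p.1 + w) - u p.1)) ∂P := by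
          have hi : ∀ x, Integrable (fun w => u (x + w) - u x) P := fun x =>
            (hshift_int x).sub (integrable_const _)
          rw [integral_sub (hi _) (hi _), ← hdiff, ← hdiff]
          rfl
        rw [e1, ← integral_mul_const]
        refine integral_congr_ae (hPc.mono fun w hw => ?_)
        have hpw : p + (w, w) ∈ D ×ˢ D := ⟨hDw w hw _ hp.1, hDw w hw _ hp.2⟩
        simp only [U, Set.indicator_of_mem hp, Set.indicator_of_mem hpw, graphGrad, Prod.fst_add,
          Prod.snd_add, add_sub_add_right_eq_sub]
        ring
      rw [← hsq, this]
      exact enorm_integral_sq_le (Measurable.aestronglyMeasurable (by fun_prop))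
    calc levyEnergy ν (volume.restrict D) (v - u)
        ≤ ∫⁻ p in D ×ˢ D, ∫⁻ w, ‖U (p + (w, w)) - U p‖ₑ ^ 2 ∂P
            ∂(Measure.prod volume volume) := by
          rw [levyEnergy, Measure.prod_restrict]
          exact setLIntegral_mono' (hD.prod hD) hpt
      _ ≤ ∫⁻ p, ∫⁻ w, ‖U (p + (w, w)) - U p‖ₑ ^ 2 ∂P ∂(Measure.prod volume volume) :=
          setLIntegral_le_lintegral _ _
      _ = ∫⁻ w, ∫⁻ p, ‖U (p + (w, w)) - U p‖ₑ ^ 2 ∂(Measure.prod volume volume) ∂P := by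
          rw [lintegral_lintegral_swap]
          exact Measurable.aemeasurable (by fun_prop)
      _ ≤ ∫⁻ w, ε ∂P := by
          refine lintegral_mono_ae (hPc.mono fun w hw => ?_)
          have := (hball w ((Metric.ball_subset_ball (min_le_right _ _)) (hsub hw))).2
          have := this.trans (min_le_right _ _)
          calc _ = eLpNorm ((fun p => U (p + (w, w))) - U) 2 (Measure.prod volume volume) ^ 2 :=
                (eLpNorm_two_sq _).symm
            _ ≤ (ε ^ (1 / 2 : ℝ)) ^ 2 := by gcongr
            _ = ε := by rw [← ENNReal.rpow_mul_natCast]; norm_num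
      _ = ε := by simp

end Mollification

/-! ### Approximation, from local to global -/

section Approximation

variable {d : ℕ}

/-- Approximability by bounded Lipschitz functions in `L¹(π)` and in energy. -/
def LipschitzApproximable (ν : EuclideanSpace ℝ (Fin d) → ℝ≥0)
    (π : Measure (EuclideanSpace ℝ (Fin d))) (u : EuclideanSpace ℝ (Fin d) → ℝ) : Prop :=
  ∀ ε : ℝ≥0∞, ε ≠ 0 → ∃ v : EuclideanSpace ℝ (Fin d) → ℝ, Measurable v ∧ IsBoundedLipschitz v ∧
    ∫⁻ x, ‖v x - u x‖ₑ ∂π ≤ ε ∧ levyEnergy ν π (v - u) ≤ ε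

theorem IsBoundedLipschitz.add {V : Type*} [PseudoMetricSpace V] {f g : V → ℝ}
    (hf : IsBoundedLipschitz f) (hg : IsBoundedLipschitz g) : IsBoundedLipschitz (f + g) := by
  obtain ⟨⟨K, hK⟩, C, hC⟩ := hf
  obtain ⟨⟨L, hL⟩, D, hD⟩ := hg
  exact ⟨⟨K + L, hK.add hL⟩, C + D, fun x => (abs_add_le _ _).trans (add_le_add (hC x) (hD x))⟩

/-- Approximability is closed under limits. The energy is only subadditive up to the factor `2`,
hence the `ε / 4`. -/
theorem LipschitzApproximable.of_approx {ν : EuclideanSpace ℝ (Fin d) → ℝ≥0} (hν : Measurable ν)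
    {π : Measure (EuclideanSpace ℝ (Fin d))} {u : EuclideanSpace ℝ (Fin d) → ℝ}
    (h : ∀ ε : ℝ≥0∞, ε ≠ 0 → ∃ w : EuclideanSpace ℝ (Fin d) → ℝ, Measurable w ∧
      LipschitzApproximable ν π w ∧ ∫⁻ x, ‖w x - u x‖ₑ ∂π ≤ ε ∧ levyEnergy ν π (w - u) ≤ ε) :
    LipschitzApproximable ν π u := by
  intro ε hε
  have hε4 : ε / 4 ≠ 0 := ENNReal.div_ne_zero.2 ⟨hε, by simp⟩
  obtain ⟨w, hwm, hw, hw1, hw2⟩ := h (ε / 4) hε4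
  obtain ⟨v, hvm, hv, hv1, hv2⟩ := hw (ε / 4) hε4
  have h4 : 2 * (ε / 4) + 2 * (ε / 4) = ε := by
    rw [← add_mul, show (2 + 2 : ℝ≥0∞) = 4 by norm_num,
      ENNReal.mul_div_cancel (by simp) (by simp)]
  refine ⟨v, hvm, hv, ?_, ?_⟩
  · calc ∫⁻ x, ‖v x - u x‖ₑ ∂π ≤ ∫⁻ x, ‖v x - w x‖ₑ + ‖w x - u x‖ₑ ∂π :=
          lintegral_mono fun x => by
            have := enorm_add_le (v x - w x) (w x - u x)
            rwa [sub_add_sub_cancel] at this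
      _ = ∫⁻ x, ‖v x - w x‖ₑ ∂π + ∫⁻ x, ‖w x - u x‖ₑ ∂π :=
          lintegral_add_left (by fun_prop) _
      _ ≤ ε / 4 + ε / 4 := by gcongr
      _ ≤ 2 * (ε / 4) + 2 * (ε / 4) := by
          rw [two_mul]; exact add_le_add le_self_add le_self_add
      _ = ε := h4
  · have : v - u = (v - w) + (w - u) := by abel
    rw [this]
    refine (levyEnergy_add_le hν (hvm.sub hwm)).trans ?_
    rw [← h4]
    gcongr

theorem LipschitzApproximable.add {ν : EuclideanSpace ℝ (Fin d) → ℝ≥0} (hν : Measurable ν)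
    {π : Measure (EuclideanSpace ℝ (Fin d))} {f g : EuclideanSpace ℝ (Fin d) → ℝ}
    (hfm : Measurable f) (hf : LipschitzApproximable ν π f) (hg : LipschitzApproximable ν π g) :
    LipschitzApproximable ν π (f + g) := by
  intro ε hε
  have hε4 : ε / 4 ≠ 0 := ENNReal.div_ne_zero.2 ⟨hε, by simp⟩
  obtain ⟨w, hwm, hw, hw1, hw2⟩ := hg (ε / 4) hε4
  obtain ⟨v, hvm, hv, hv1, hv2⟩ := hf (ε / 4) hε4
  have h4 : 2 * (ε / 4) + 2 * (ε / 4) = ε := by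
    rw [← add_mul, show (2 + 2 : ℝ≥0∞) = 4 by norm_num,
      ENNReal.mul_div_cancel (by simp) (by simp)]
  refine ⟨v + w, hvm.add hwm, hv.add hw, ?_, ?_⟩
  · calc ∫⁻ x, ‖(v + w) x - (f + g) x‖ₑ ∂π ≤ ∫⁻ x, ‖v x - f x‖ₑ + ‖w x - g x‖ₑ ∂π :=
          lintegral_mono fun x => by
            have := enorm_add_le (v x - f x) (w x - g x)
            rwa [← add_sub_add_comm] at this
      _ = ∫⁻ x, ‖v x - f x‖ₑ ∂π + ∫⁻ x, ‖w x - g x‖ₑ ∂π :=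
          lintegral_add_left (by fun_prop) _
      _ ≤ ε / 4 + ε / 4 := by gcongr
      _ ≤ 2 * (ε / 4) + 2 * (ε / 4) := by
          rw [two_mul]; exact add_le_add le_self_add le_self_add
      _ = ε := h4
  · have : v + w - (f + g) = (v - f) + (w - g) := by abel
    rw [this]
    refine (levyEnergy_add_le hν (hvm.sub hfm)).trans ?_
    rw [← h4]
    gcongr

theorem LipschitzApproximable.mono_measure {ν : EuclideanSpace ℝ (Fin d) → ℝ≥0}
    {π π' : Measure (EuclideanSpace ℝ (Fin d))} [SFinite π'] {C : ℝ≥0} (hC : π ≤ C • π')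
    {u : EuclideanSpace ℝ (Fin d) → ℝ} (hu : LipschitzApproximable ν π' u) :
    LipschitzApproximable ν π u := by
  intro ε hε
  -- The `L¹` error scales by `C`, the energy by `C ^ 2`; the sum serves both.
  set S : ℝ≥0∞ := C + (C : ℝ≥0∞) ^ 2 with hS
  have hS' : S ≠ ∞ := by finiteness
  obtain ⟨v, hvm, hv, h1, h2⟩ := hu (ε / S) (ENNReal.div_ne_zero.2 ⟨hε, hS'⟩)
  have hle : S * (ε / S) ≤ ε := ENNReal.mul_div_le
  refine ⟨v, hvm, hv, ?_, ?_⟩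
  · refine (lintegral_mono' hC le_rfl).trans (le_trans ?_ hle)
    rw [lintegral_smul_measure, ENNReal.smul_def, smul_eq_mul]
    gcongr
    exact le_self_add
  · refine (levyEnergy_mono_measure hC _).trans (le_trans ?_ hle)
    gcongr
    exact le_add_self

theorem levyEnergy_mono_set {ν : EuclideanSpace ℝ (Fin d) → ℝ≥0}
    {A B : Set (EuclideanSpace ℝ (Fin d))} (h : A ⊆ B) (f : EuclideanSpace ℝ (Fin d) → ℝ) :
    levyEnergy ν (volume.restrict A) f ≤ levyEnergy ν (volume.restrict B) f :=
  lintegral_mono' (Measure.prod_mono (Measure.restrict_mono h le_rfl)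
    (Measure.restrict_mono h le_rfl)) le_rfl

/-- A function supported in a ball is approximable on `A` when, on a larger ball, `A` agrees with
a set having inward shifts. -/
theorem lipschitzApproximable_of_support {ν : EuclideanSpace ℝ (Fin d) → ℝ≥0}
    (hν : IsSymmetricLevyDensity ν) {A D : Set (EuclideanSpace ℝ (Fin d))}
    (hA : MeasurableSet A) (hD : MeasurableSet D) (hsh : HasInwardShifts D)
    {z : EuclideanSpace ℝ (Fin d)} {ρ r : ℝ} (hρ : ρ < r)
    (hAD : A ∩ Metric.ball z r = D ∩ Metric.ball z r)
    {u : EuclideanSpace ℝ (Fin d) → ℝ} (hu : Measurable u) {M : ℝ≥0} (huM : ∀ x, |u x| ≤ M)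
    (hsupp : ∀ x, x ∉ Metric.ball z ρ → u x = 0)
    (hE : levyEnergy ν (volume.restrict (A ∩ Metric.ball z r)) u < ∞) :
    LipschitzApproximable ν (volume.restrict A) u := by
  intro ε hε
  have henorm : ∀ x, ‖u x‖ₑ ≤ M := fun x => by
    rw [← ofReal_norm, ← ENNReal.ofReal_coe_nnreal]; exact ENNReal.ofReal_le_ofReal (huM _)
  have hui : Integrable u volume := by
    have : IntegrableOn u (Metric.ball z ρ) volume :=
      Measure.integrableOn_of_bounded measure_ball_lt_top.ne hu.aestronglyMeasurable
        (ae_of_all _ huM)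
    exact (integrableOn_iff_integrable_of_support_subset
      fun x hx => by_contra fun h => hx (hsupp x h)).1 this
  -- Finite energy on the common piece extends to all of `D`, since the long jumps cost only a
  -- finite tail.
  have hED : levyEnergy ν (volume.restrict D) u < ∞ := by
    refine (levyEnergy_restrict_le_of_support hν.measurable hD hu hsupp hρ.le).trans_lt ?_
    rw [← hAD]
    refine ENNReal.add_lt_top.2 ⟨hE, ENNReal.mul_lt_top (by simp) (ENNReal.mul_lt_top ?_
      (hν.tail_lt_top (sub_pos.2 hρ)))⟩
    calc ∫⁻ x in A ∩ Metric.ball z r, ‖u x‖ₑ ^ 2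
        ≤ ∫⁻ x in A ∩ Metric.ball z r, (M : ℝ≥0∞) ^ 2 :=
          lintegral_mono fun x => pow_le_pow_left' (henorm x) 2
      _ < ∞ := by
          rw [setLIntegral_const]
          exact ENNReal.mul_lt_top (by finiteness)
            ((measure_mono Set.inter_subset_right).trans_lt measure_ball_lt_top)
  -- Mollifying enlarges the support by `η`; a gap to radius `r` must remain for the tail bound on
  -- `v - u`.
  obtain ⟨η, hη, hηr⟩ : ∃ η > 0, ρ + η < r := ⟨(r - ρ) / 2, by linarith, by linarith⟩
  set T : ℝ≥0∞ := ∫⁻ h, {h | r - (ρ + η) ≤ ‖h‖}.indicator (fun h => (ν h : ℝ≥0∞)) h with hT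
  have hT' : T < ∞ := hν.tail_lt_top (sub_pos.2 hηr)
  -- The `1` pays for the energy on `D`; the other term for long jumps, where `|v - u|² ≤ 2M |v -
  -- u|` turns `L¹` smallness into `L²` smallness.
  set S : ℝ≥0∞ := 1 + 2 * (2 * M * T) with hS
  have hS' : S ≠ ∞ := by finiteness
  obtain ⟨v, ⟨K, hK⟩, hvM, hvs, h1, h2⟩ := exists_lipschitz_approx hν.measurable hD hsh hu huM hui
    hED (ENNReal.div_ne_zero.2 ⟨hε, hS'⟩ : ε / S ≠ 0) hη
  have hle : S * (ε / S) ≤ ε := ENNReal.mul_div_le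
  have hvm : Measurable v := hK.continuous.measurable
  refine ⟨v, hvm, ⟨⟨K, hK⟩, M, hvM⟩, ?_, ?_⟩
  · refine (setLIntegral_le_lintegral _ _).trans (h1.trans (le_trans ?_ hle))
    exact le_mul_of_one_le_left zero_le le_self_add
  · have hs : ∀ x, x ∉ Metric.ball z (ρ + η) → (v - u) x = 0 := fun x hx => by
      rw [Pi.sub_apply, hvs z ρ hsupp x hx,
        hsupp x fun h => hx (Metric.ball_subset_ball (by linarith) h), sub_zero]
    refine (levyEnergy_restrict_le_of_support hν.measurable hA (hvm.sub hu) hs hηr.le).trans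
      (le_trans ?_ hle)
    rw [← hT, hAD, hS, add_mul, one_mul]
    gcongr ?_ + ?_
    · exact (levyEnergy_mono_set Set.inter_subset_left _).trans h2
    · rw [mul_assoc 2, mul_right_comm]
      gcongr
      calc ∫⁻ x in D ∩ Metric.ball z r, ‖(v - u) x‖ₑ ^ 2
          ≤ ∫⁻ x, ‖(v - u) x‖ₑ ^ 2 := setLIntegral_le_lintegral _ _
        _ ≤ ∫⁻ x, 2 * M * ‖v x - u x‖ₑ := by
            refine lintegral_mono fun x => ?_
            rw [sq, Pi.sub_apply]
            gcongr
            rw [← ofReal_norm, Real.norm_eq_abs, show (2 : ℝ≥0∞) * M = ENNReal.ofReal (2 * M) by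
              rw [ENNReal.ofReal_mul (by norm_num)]; simp]
            refine ENNReal.ofReal_le_ofReal ((abs_sub _ _).trans ?_)
            linarith [huM x, hvM x]
        _ = 2 * M * ∫⁻ x, ‖v x - u x‖ₑ := lintegral_const_mul' _ _ (by finiteness)
        _ ≤ 2 * M * (ε / S) := by gcongr

theorem exists_lipschitz_cutoff (z : EuclideanSpace ℝ (Fin d)) {a b : ℝ} (hab : a < b) :
    ∃ ψ : EuclideanSpace ℝ (Fin d) → ℝ, LipschitzWith (b - a)⁻¹.toNNReal ψ ∧ (∀ x, 0 ≤ ψ x) ∧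
      (∀ x, ψ x ≤ 1) ∧ (∀ x ∈ Metric.ball z a, ψ x = 1) ∧ ∀ x ∉ Metric.ball z b, ψ x = 0 := by
  have hs : 0 < b - a := sub_pos.2 hab
  refine ⟨fun x => max 0 (min 1 ((b - a)⁻¹ * (b - dist x z))), ?_, fun x => le_max_left _ _,
    fun x => max_le zero_le_one (min_le_left _ _), fun x hx => ?_, fun x hx => ?_⟩
  · have : LipschitzWith (b - a)⁻¹.toNNReal
        fun x : EuclideanSpace ℝ (Fin d) => (b - a)⁻¹ * (b - dist x z) := by
      refine LipschitzWith.of_dist_le_mul fun x y => ?_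
      rw [Real.coe_toNNReal _ (by positivity), Real.dist_eq, ← mul_sub, abs_mul,
        abs_of_nonneg (by positivity : 0 ≤ (b - a)⁻¹), sub_sub_sub_cancel_left, abs_sub_comm]
      gcongr
      exact abs_dist_sub_le _ _ _
    exact (this.const_min 1).const_max 0
  · have : 1 ≤ (b - a)⁻¹ * (b - dist x z) := by
      rw [← div_eq_inv_mul, one_le_div hs]; linarith [Metric.mem_ball.1 hx]
    simp only [min_eq_left this, max_eq_right zero_le_one]
  · have : (b - a)⁻¹ * (b - dist x z) ≤ 0 :=
      mul_nonpos_of_nonneg_of_nonpos (by positivity)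
        (by rw [Metric.mem_ball, not_lt] at hx; linarith)
    exact max_eq_left ((min_le_right _ _).trans this)

theorem hasInwardShifts_univ : HasInwardShifts (Set.univ : Set (EuclideanSpace ℝ (Fin d))) :=
  fun η hη => ⟨0, η, hη, le_rfl, fun _ _ _ _ => trivial⟩

/-- Approximability for measures which are comparable to Lebesgue measure on balls. -/
theorem lipschitzApproximable_of_locally_comparable {ν : EuclideanSpace ℝ (Fin d) → ℝ≥0}
    (hν : IsSymmetricLevyDensity ν) {π : Measure (EuclideanSpace ℝ (Fin d))} [IsFiniteMeasure π]
    {C : ℝ≥0} (hC : π ≤ C • volume)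
    (hloc : ∀ R : ℝ, ∃ c : ℝ≥0, volume.restrict (Metric.ball 0 R) ≤ c • π)
    {u : EuclideanSpace ℝ (Fin d) → ℝ} (hu : Measurable u) {M : ℝ≥0} (huM : ∀ x, |u x| ≤ M)
    (hE : levyEnergy ν π u < ∞) : LipschitzApproximable ν π u := by
  have hνm := hν.measurable
  have hψ : ∀ n : ℕ, ∃ ψ : EuclideanSpace ℝ (Fin d) → ℝ, LipschitzWith 1 ψ ∧ (∀ x, 0 ≤ ψ x) ∧
      (∀ x, ψ x ≤ 1) ∧ (∀ x ∈ Metric.ball (0 : EuclideanSpace ℝ (Fin d)) n, ψ x = 1) ∧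
      ∀ x ∉ Metric.ball (0 : EuclideanSpace ℝ (Fin d)) (n + 1), ψ x = 0 := fun n => by
    have := exists_lipschitz_cutoff (0 : EuclideanSpace ℝ (Fin d)) (lt_add_one (n : ℝ))
    simpa using this
  choose ψ hψL hψ0 hψ1 hψin hψout using hψ
  have hψm : ∀ n, Measurable (ψ n) := fun n => (hψL n).continuous.measurable
  have hψabs : ∀ n x, |ψ n x| ≤ 1 := fun n x => abs_le.2 ⟨by linarith [hψ0 n x], hψ1 n x⟩
  have hev : ∀ x, ∀ᶠ n in atTop, ψ n x = 1 := fun x => by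
    obtain ⟨N, hN⟩ := exists_nat_gt (dist x 0)
    filter_upwards [eventually_ge_atTop N] with n hn
    exact hψin n x (Metric.mem_ball.2 (hN.trans_le (by exact_mod_cast hn)))
  have henorm : ∀ x, ‖u x‖ₑ ≤ M := fun x => by
    rw [← ofReal_norm, ← ENNReal.ofReal_coe_nnreal]; exact ENNReal.ofReal_le_ofReal (huM _)
  have hmul : ∀ n x, |(ψ n * u) x| ≤ M := fun n x => by
    rw [Pi.mul_apply, abs_mul]
    exact (mul_le_of_le_one_left (abs_nonneg _) (hψabs n x)).trans (huM x)
  have happ : ∀ n, LipschitzApproximable ν π (ψ n * u) := fun n => by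
    -- The upper bound on `π` reduces approximation to Lebesgue measure; the lower bound on a ball
    -- then supplies the finite Lebesgue energy needed there.
    refine LipschitzApproximable.mono_measure (π' := volume.restrict Set.univ) (C := C)
      (by simpa using hC) ?_
    have hsupp : ∀ x, x ∉ Metric.ball (0 : EuclideanSpace ℝ (Fin d)) (n + 1) →
        (ψ n * u) x = 0 := fun x hx => by simp [hψout n x hx]
    refine lipschitzApproximable_of_support hν MeasurableSet.univ MeasurableSet.univ
      hasInwardShifts_univ (lt_add_one ((n : ℝ) + 1)) rfl ((hψm n).mul hu) (hmul n) hsupp ?_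
    rw [Set.univ_inter]
    obtain ⟨c, hc⟩ := hloc (n + 1 + 1)
    have : IsFiniteMeasure ((volume : Measure (EuclideanSpace ℝ (Fin d))).restrict
      (Metric.ball 0 ((n : ℝ) + 1 + 1))) := ⟨by simpa using measure_ball_lt_top⟩
    refine levyEnergy_mul_lt_top hν (C := 1) (by simpa using Measure.restrict_le_self) hu huM
      ((levyEnergy_mono_measure hc u).trans_lt ?_) (hψL n) (hψ0 n) (hψ1 n)
    exact ENNReal.mul_lt_top (by finiteness) hE
  have hL1 : Tendsto (fun n => ∫⁻ x, ‖(ψ n * u) x - u x‖ₑ ∂π) atTop (𝓝 0) := by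
    have := tendsto_lintegral_of_dominated_convergence (μ := π)
      (F := fun n x => ‖(ψ n * u) x - u x‖ₑ) (f := fun _ => 0) (fun _ => 2 * (M : ℝ≥0∞))
      (fun n => by have := hψm n; simp only [Pi.mul_apply]; fun_prop)
      (fun n => ae_of_all _ fun x => ?_) ?_ (ae_of_all _ fun x => ?_)
    · simpa using this
    · dsimp only
      rw [← ofReal_norm, Real.norm_eq_abs, show (2 : ℝ≥0∞) * M = ENNReal.ofReal (2 * M) by
        rw [ENNReal.ofReal_mul (by norm_num)]; simp]
      refine ENNReal.ofReal_le_ofReal ((abs_sub _ _).trans ?_)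
      linarith [huM x, hmul n x]
    · rw [lintegral_const]; finiteness
    · refine tendsto_const_nhds.congr' ?_
      filter_upwards [hev x] with n hn
      simp [hn]
  have hEn : Tendsto (fun n => levyEnergy ν π (ψ n * u - u)) atTop (𝓝 0) := by
    -- A majorant independent of `n`: all cutoffs are 1-Lipschitz, and `∇̄(ψ n - 1) = ∇̄(ψ n)`.
    let bd : EuclideanSpace ℝ (Fin d) × EuclideanSpace ℝ (Fin d) → ℝ≥0∞ := fun p =>
      2 * (‖graphGrad u p‖ₑ ^ 2 * (ν (p.2 - p.1) : ℝ≥0∞)) + (2 * (M : ℝ≥0∞) ^ 2) *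
        (min 1 (ENNReal.ofReal (‖p.2 - p.1‖ ^ 2)) * (ν (p.2 - p.1) : ℝ≥0∞))
    have := tendsto_lintegral_of_dominated_convergence (μ := π.prod π)
      (F := fun n p => ‖graphGrad (ψ n * u - u) p‖ₑ ^ 2 * (ν (p.2 - p.1) : ℝ≥0∞))
      (f := fun _ => 0) bd
      (fun n => measurable_levyEnergy_integrand hνm (((hψm n).mul hu).sub hu))
      (fun n => ae_of_all _ fun p => ?_) ?_ (ae_of_all _ fun p => ?_)
    · simp only [lintegral_zero] at this
      exact this
    · have e : ψ n * u - u = (ψ n - 1) * u := by ring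
      have e1 : graphGrad (ψ n - 1) = graphGrad (ψ n) := by ext p; simp [graphGrad]
      have hb := graphGrad_mul_enorm_sq_le (ψ := ψ n - 1) huM (fun x => by
        rw [Pi.sub_apply, Pi.one_apply, abs_le]
        constructor <;> linarith [hψ0 n x, hψ1 n x]) p
      have hl := graphGrad_enorm_sq_le_of_lipschitz (hψL n) (hψ0 n) (hψ1 n) p
      simp only [NNReal.coe_one, one_pow, max_self, ENNReal.ofReal_one, one_mul] at hl
      rw [e1] at hb
      dsimp only
      rw [e]
      calc _ ≤ (2 * ‖graphGrad u p‖ₑ ^ 2 + 2 * ((M : ℝ≥0∞) ^ 2 *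
            min 1 (ENNReal.ofReal (‖p.2 - p.1‖ ^ 2)))) * (ν (p.2 - p.1) : ℝ≥0∞) := by
            gcongr
            refine hb.trans ?_
            gcongr
        _ = bd p := by simp only [bd]; ring
    · simp only [bd]
      rw [lintegral_add_left ((measurable_levyEnergy_integrand hνm hu).const_mul _),
        lintegral_const_mul' _ _ (by simp), lintegral_const_mul' _ _ (by finiteness)]
      exact (ENNReal.add_lt_top.2 ⟨ENNReal.mul_lt_top (by simp) hE,
        ENNReal.mul_lt_top (by finiteness) (lintegral_min_mul_levy_lt_top hν hC)⟩).ne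
    · refine tendsto_const_nhds.congr' ?_
      filter_upwards [hev p.1, hev p.2] with n h1 h2
      simp [graphGrad, h1, h2]
  refine LipschitzApproximable.of_approx hνm fun ε hε => ?_
  have hpos := pos_iff_ne_zero.2 hε
  obtain ⟨n, h1, h2⟩ := ((hL1.eventually_le_const hpos).and (hEn.eventually_le_const hpos)).exists
  exact ⟨ψ n * u, (hψm n).mul hu, happ n, h1, h2⟩

/-- Approximability on a bounded set which locally agrees with sets having inward shifts. -/
theorem lipschitzApproximable_of_locally_inward {ν : EuclideanSpace ℝ (Fin d) → ℝ≥0}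
    (hν : IsSymmetricLevyDensity ν) {Ω : Set (EuclideanSpace ℝ (Fin d))} (hΩ : MeasurableSet Ω)
    (hb : Bornology.IsBounded Ω)
    (hloc : ∀ z ∈ closure Ω, ∃ r > (0 : ℝ), ∃ D : Set (EuclideanSpace ℝ (Fin d)),
      MeasurableSet D ∧ HasInwardShifts D ∧ Ω ∩ Metric.ball z r = D ∩ Metric.ball z r)
    {u : EuclideanSpace ℝ (Fin d) → ℝ} (hu : Measurable u) {M : ℝ≥0} (huM : ∀ x, |u x| ≤ M)
    (hE : levyEnergy ν (volume.restrict Ω) u < ∞) :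
    LipschitzApproximable ν (volume.restrict Ω) u := by
  have hνm := hν.measurable
  have hfin : IsFiniteMeasure ((volume : Measure (EuclideanSpace ℝ (Fin d))).restrict Ω) :=
    ⟨by simpa using hb.measure_lt_top⟩
  choose! r hr D hDm hDs hDe using hloc
  -- Cover by radius `r/3`, so that a cutoff equal to `1` there can vanish outside `r/2`, strictly
  -- inside the ball where `Ω` agrees with `D z`.
  obtain ⟨t, ht, hcov⟩ := hb.isCompact_closure.elim_nhds_subcover (fun z => Metric.ball z (r z / 3))
    fun z hz => Metric.ball_mem_nhds z (by linarith [hr z hz])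
  -- The induction invariant: unlike the covering itself, it survives removing a ball once `u` is
  -- replaced by `(1 - ψ) * u`.
  have hcov' : ∀ x ∈ Ω, (∀ z ∈ t, x ∉ Metric.ball z (r z / 3)) → u x = 0 := fun x hx h => by
    obtain ⟨z, hz, hxz⟩ := Set.mem_iUnion₂.1 (hcov (subset_closure hx))
    exact absurd hxz (h z hz)
  clear hcov
  induction t using Finset.induction_on generalizing u with
  | empty =>
    intro ε hε
    have h0 : ∀ x ∈ Ω, u x = 0 := fun x hx => hcov' x hx (by simp)
    have hae : ∀ᵐ x ∂(volume.restrict Ω), u x = 0 := (ae_restrict_iff' hΩ).2 (ae_of_all _ h0)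
    refine ⟨0, measurable_const, ⟨⟨0, LipschitzWith.const 0⟩, 0, by simp⟩, ?_, ?_⟩
    · rw [lintegral_congr_ae (g := fun _ => 0) (hae.mono fun x hx => by simp [hx])]
      simp
    · rw [levyEnergy, Measure.prod_restrict,
        setLIntegral_congr_fun (g := fun _ => 0) (hΩ.prod hΩ)
          (fun p hp => by simp [graphGrad, h0 _ hp.1, h0 _ hp.2])]
      simp
  | insert z t hzt ih =>
    have hz := ht z (Finset.mem_insert_self z t)
    have hrz := hr z hz
    obtain ⟨ψ, hψL, hψ0, hψ1, hψin, hψout⟩ :=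
      exists_lipschitz_cutoff z (by linarith : r z / 3 < r z / 2)
    have hψm : Measurable ψ := hψL.continuous.measurable
    have hψL' : LipschitzWith (r z / 2 - r z / 3)⁻¹.toNNReal (1 - ψ) := by
      refine LipschitzWith.of_dist_le_mul fun x y => ?_
      have := hψL.dist_le_mul x y
      rwa [Pi.sub_apply, Pi.sub_apply, Pi.one_apply, Pi.one_apply, dist_sub_left]
    have h01 : ∀ x, 0 ≤ (1 - ψ) x := fun x => sub_nonneg.2 (hψ1 x)
    have h11 : ∀ x, (1 - ψ) x ≤ 1 := fun x => sub_le_self _ (hψ0 x)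
    have hbd : ∀ χ : EuclideanSpace ℝ (Fin d) → ℝ, (∀ x, 0 ≤ χ x) → (∀ x, χ x ≤ 1) →
        ∀ x, |(χ * u) x| ≤ M := fun χ h0 h1 x => by
      rw [Pi.mul_apply, abs_mul, abs_of_nonneg (h0 x)]
      exact (mul_le_of_le_one_left (abs_nonneg _) (h1 x)).trans (huM x)
    have hle : (volume : Measure (EuclideanSpace ℝ (Fin d))).restrict Ω ≤ (1 : ℝ≥0) • volume := by
      simpa using Measure.restrict_le_self
    have hE1 := levyEnergy_mul_lt_top hν hle hu huM hE hψL hψ0 hψ1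
    have hE2 := levyEnergy_mul_lt_top hν hle hu huM hE hψL' h01 h11
    have e : u = ψ * u + (1 - ψ) * u := by ring
    rw [e]
    refine LipschitzApproximable.add hνm (hψm.mul hu) ?_ ?_
    · exact lipschitzApproximable_of_support hν hΩ (hDm z hz) (hDs z hz)
        (by linarith : r z / 2 < r z) (hDe z hz) (hψm.mul hu) (hbd ψ hψ0 hψ1)
        (fun x hx => by simp [hψout x hx])
        ((levyEnergy_mono_set Set.inter_subset_left _).trans_lt hE1)
    · refine ih ((measurable_const.sub hψm).mul hu) (hbd _ h01 h11) hE2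
        (fun x hx => ht x (Finset.mem_insert_of_mem hx)) fun x hx h => ?_
      by_cases hxz : x ∈ Metric.ball z (r z / 3)
      · simp [hψin x hxz]
      · have : u x = 0 := hcov' x hx fun y hy => by
          obtain rfl | hy := Finset.mem_insert.1 hy
          exacts [hxz, h y hy]
        simp [this]

end Approximation

/-! ### Reduction of the density property to approximability -/

section Reduction

theorem edgeMeasure_const_withDensity {V : Type*} [MeasurableSpace V] (π : Measure V) [SFinite π]
    {k : V → V → ℝ≥0} (hk : Measurable (Function.uncurry k)) :
    edgeMeasure π ((Kernel.const V π).withDensity fun x y => (k x y : ℝ≥0∞)) =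
      (π.prod π).withDensity fun p => (k p.1 p.2 : ℝ≥0∞) := by
  have hk' : Measurable (Function.uncurry fun x y => (k x y : ℝ≥0∞)) := hk.coe_nnreal_ennreal
  ext s hs
  rw [edgeMeasure, Measure.compProd_apply hs, withDensity_apply _ hs, ← lintegral_indicator hs,
    lintegral_prod _ (by exact (hk'.indicator hs).aemeasurable)]
  refine lintegral_congr fun x => ?_
  have hsx : MeasurableSet (Prod.mk x ⁻¹' s) := measurable_prodMk_left hs
  rw [Kernel.withDensity_apply _ hk', Kernel.const_apply, withDensity_apply _ hsx,
    ← lintegral_indicator hsx]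
  rfl

/-- Truncating a measurable version at the essential supremum makes the bound hold everywhere. -/
theorem exists_measurable_bounded_ae_eq {V : Type*} [MeasurableSpace V] {π : Measure V}
    {φ : V → ℝ} (hφ : MemLp φ ∞ π) :
    ∃ (u : V → ℝ) (M : ℝ≥0), Measurable u ∧ (∀ x, |u x| ≤ M) ∧ u =ᵐ[π] φ := by
  set M : ℝ≥0 := (eLpNorm φ ∞ π).toNNReal with hM
  have hφM : ∀ᵐ x ∂π, |φ x| ≤ M := by
    have h := ae_le_eLpNormEssSup (f := φ) (μ := π)
    rw [← eLpNorm_exponent_top, ← ENNReal.coe_toNNReal hφ.2.ne] at h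
    filter_upwards [h] with x hx
    rw [enorm_le_coe] at hx
    exact_mod_cast hx
  refine ⟨fun x => max (-M) (min M (hφ.1.mk φ x)), M, ?_, fun x => ?_, ?_⟩
  · have := hφ.1.stronglyMeasurable_mk.measurable
    fun_prop
  · exact abs_le.2 ⟨le_max_left _ _,
      max_le (by linarith [M.coe_nonneg]) (min_le_left _ _)⟩
  · filter_upwards [hφM, hφ.1.ae_eq_mk] with x hx he
    rw [← he, min_eq_right (abs_le.1 hx).2, max_eq_right (abs_le.1 hx).1]

/-- The density property follows from approximability of bounded measurable functions. -/
theorem densityProperty_of_approx {V : Type*} [MetricSpace V] [SecondCountableTopology V]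
    [MeasurableSpace V] [BorelSpace V] (π : Measure V) [SFinite π] {k : V → V → ℝ≥0}
    (hk : Measurable (Function.uncurry k))
    (H : ∀ (u : V → ℝ) (M : ℝ≥0), Measurable u → (∀ x, |u x| ≤ M) →
      ∫⁻ p, ‖graphGrad u p‖ₑ ^ 2 * (k p.1 p.2 : ℝ≥0∞) ∂(π.prod π) < ∞ →
      ∀ ε : ℝ≥0∞, ε ≠ 0 → ∃ v : V → ℝ, IsBoundedLipschitz v ∧ ∫⁻ x, ‖v x - u x‖ₑ ∂π ≤ ε ∧
        ∫⁻ p, ‖graphGrad (v - u) p‖ₑ ^ 2 * (k p.1 p.2 : ℝ≥0∞) ∂(π.prod π) ≤ ε) :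
    DensityProperty π ((Kernel.const V π).withDensity fun x y => (k x y : ℝ≥0∞)) := by
  have hk' : Measurable fun p : V × V => (k p.1 p.2 : ℝ≥0∞) := hk.coe_nnreal_ennreal
  have hΘ := edgeMeasure_const_withDensity π hk
  set Θ := edgeMeasure π ((Kernel.const V π).withDensity fun x y => (k x y : ℝ≥0∞)) with hΘdef
  have hlin : ∀ f : V → ℝ, Measurable f → ∫⁻ p, ‖graphGrad f p‖ₑ ^ 2 ∂Θ =
      ∫⁻ p, ‖graphGrad f p‖ₑ ^ 2 * (k p.1 p.2 : ℝ≥0∞) ∂(π.prod π) := fun f hf => by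
    have := measurable_graphGrad hf
    rw [hΘ, lintegral_withDensity_eq_lintegral_mul _ hk' (by fun_prop)]
    exact lintegral_congr fun p => by rw [Pi.mul_apply, mul_comm]
  rintro φ ⟨hφ, hφE⟩
  obtain ⟨u, M, hu, huM, hue⟩ := exists_measurable_bounded_ae_eq hφ
  have hgrad : graphGrad u =ᵐ[Θ] graphGrad φ := by
    have h : graphGrad u =ᵐ[π.prod π] graphGrad φ := by
      filter_upwards [Measure.quasiMeasurePreserving_fst.ae hue,
        Measure.quasiMeasurePreserving_snd.ae hue] with p h1 h2
      simp only [graphGrad, h1, h2]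
    rw [hΘ]
    exact (withDensity_absolutelyContinuous _ _).ae_eq h
  have hE : ∫⁻ p, ‖graphGrad u p‖ₑ ^ 2 * (k p.1 p.2 : ℝ≥0∞) ∂(π.prod π) < ∞ := by
    rw [← hlin u hu, lintegral_congr_ae (hgrad.mono fun p hp => by
      simp only [hp] : _ =ᵐ[Θ] fun p => ‖graphGrad φ p‖ₑ ^ 2)]
    -- The gradient vanishes on the diagonal, so integrating over `E` or `E'` is the same.
    refine lt_of_le_of_lt (le_of_eq ?_) hφE
    have hdiag : MeasurableSet {p : V × V | p.1 ≠ p.2} :=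
      (measurableSet_eq_fun measurable_fst measurable_snd).compl
    rw [← lintegral_indicator hdiag]
    refine lintegral_congr fun p => ?_
    by_cases hp : p.1 = p.2
    · rw [Set.indicator_of_notMem (by simpa using hp)]
      simp [graphGrad, hp]
    · rw [Set.indicator_of_mem (by simpa using hp), enorm_sq_eq_ofReal]
  -- The tolerance is squared because the energy is the square of the `L²` norm.
  have hpos : ∀ n : ℕ, ((n : ℝ≥0∞) + 1)⁻¹ ^ 2 ≠ 0 := fun n => by
    refine pow_ne_zero _ (ENNReal.inv_ne_zero.2 (by finiteness))
  choose v hv h1 h2 using fun n : ℕ => H u M hu huM hE _ (hpos n)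
  have hlim : Tendsto (fun n : ℕ => ((n : ℝ≥0∞) + 1)⁻¹) atTop (𝓝 0) := by
    have := (tendsto_add_atTop_iff_nat 1).2 ENNReal.tendsto_inv_nat_nhds_zero
    simpa using this
  refine ⟨v, hv, ?_, ?_⟩
  · have hlim2 : Tendsto (fun n : ℕ => ((n : ℝ≥0∞) + 1)⁻¹ ^ 2) atTop (𝓝 0) := by
      have := ENNReal.Tendsto.pow (n := 2) hlim
      simpa using this
    refine tendsto_of_tendsto_of_tendsto_of_le_of_le tendsto_const_nhds hlim2
      (fun _ => zero_le) fun n => ?_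
    dsimp only
    rw [eLpNorm_one_eq_lintegral_enorm, lintegral_congr_ae (hue.mono fun x hx => by
      simp only [Pi.sub_apply, ← hx] : _ =ᵐ[π] fun x => ‖v n x - u x‖ₑ)]
    exact h1 n
  · refine tendsto_of_tendsto_of_tendsto_of_le_of_le tendsto_const_nhds hlim
      (fun _ => zero_le) fun n => ?_
    have hvm : Measurable (v n) := (hv n).1.choose_spec.continuous.measurable
    dsimp only
    rw [← ENNReal.pow_le_pow_left_iff (two_ne_zero), eLpNorm_two_sq,
      lintegral_congr_ae (hgrad.mono fun p hp => by
        simp only [graphGrad_sub, Pi.sub_apply, hp] :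
        _ =ᵐ[Θ] fun p => ‖graphGrad (v n - u) p‖ₑ ^ 2), hlin _ (hvm.sub hu)]
    exact h2 n

/-! ### Weighted measures on `ℝ^d` -/

variable {d : ℕ}

theorem weightedMeasure_le_smul_volume {γ : EuclideanSpace ℝ (Fin d) → ℝ}
    (hγ : MemLp γ ∞ volume) : ∃ C : ℝ≥0, weightedMeasure γ ≤ C • volume := by
  refine ⟨(eLpNorm γ ∞ volume).toNNReal, ?_⟩
  rw [ENNReal.smul_def, ENNReal.coe_toNNReal hγ.2.ne, ← withDensity_const]
  refine withDensity_mono ?_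
  filter_upwards [ae_le_eLpNormEssSup (f := γ) (μ := volume)] with x hx
  rw [eLpNorm_exponent_top]
  exact (Real.ofReal_le_enorm _).trans hx

theorem isFiniteMeasure_weightedMeasure {γ : EuclideanSpace ℝ (Fin d) → ℝ}
    (hγ : MemLp γ 1 volume) : IsFiniteMeasure (weightedMeasure γ) := by
  refine isFiniteMeasure_withDensity (ne_of_lt ?_)
  refine (lintegral_mono fun x => Real.ofReal_le_enorm (γ x)).trans_lt ?_
  rw [← eLpNorm_one_eq_lintegral_enorm]
  exact hγ.2

theorem restrict_ball_le_smul_weightedMeasure {γ : EuclideanSpace ℝ (Fin d) → ℝ}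
    {z : EuclideanSpace ℝ (Fin d)} {r c : ℝ} (hc : 0 < c)
    (h : ∀ᵐ x ∂volume, x ∈ Metric.ball z r → c ≤ γ x) :
    volume.restrict (Metric.ball z r) ≤ c⁻¹.toNNReal • weightedMeasure γ := by
  rw [ENNReal.smul_def, weightedMeasure, ← withDensity_smul' _ _ (by simp),
    ← withDensity_indicator_one measurableSet_ball]
  refine withDensity_mono ?_
  filter_upwards [h] with x hx
  by_cases hxb : x ∈ Metric.ball z r
  · rw [Set.indicator_of_mem hxb, Pi.smul_apply, smul_eq_mul]
    change 1 ≤ ENNReal.ofReal c⁻¹ * _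
    rw [← ENNReal.ofReal_mul (by positivity), ← ENNReal.ofReal_one]
    refine ENNReal.ofReal_le_ofReal ?_
    rw [← div_eq_inv_mul, one_le_div hc]
    exact hx hxb
  · rw [Set.indicator_of_notMem hxb]; exact zero_le

theorem densityProperty_weighted {ν : EuclideanSpace ℝ (Fin d) → ℝ≥0}
    (hν : IsSymmetricLevyDensity ν) {γ : EuclideanSpace ℝ (Fin d) → ℝ}
    (h1 : MemLp γ 1 volume) (htop : MemLp γ ∞ volume)
    (hloc : ∀ (z : EuclideanSpace ℝ (Fin d)) (r : ℝ), ∃ c > (0 : ℝ),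
      ∀ᵐ x ∂volume, x ∈ Metric.ball z r → c ≤ γ x) :
    DensityProperty (weightedMeasure γ) (weightedLevyKernel γ ν) := by
  have hm := hν.measurable
  have := isFiniteMeasure_weightedMeasure h1
  obtain ⟨C, hC⟩ := weightedMeasure_le_smul_volume htop
  refine densityProperty_of_approx (weightedMeasure γ) (k := fun x y => ν (y - x))
    (by unfold Function.uncurry; fun_prop) fun u M hu huM hE ε hε => ?_
  obtain ⟨v, -, hv⟩ := lipschitzApproximable_of_locally_comparable hν hC (fun R => by
    obtain ⟨c, hc, hcγ⟩ := hloc 0 R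
    exact ⟨_, restrict_ball_le_smul_weightedMeasure hc hcγ⟩) hu huM hE ε hε
  exact ⟨v, hv⟩

/-! ### Lipschitz domains -/

theorem hasInwardShifts_epigraph {e : EuclideanSpace ℝ (Fin d)} (he : ‖e‖ = 1) {K : ℝ≥0}
    {g : (ℝ ∙ e)ᗮ → ℝ} (hg : LipschitzWith K g) :
    HasInwardShifts {x | g ((ℝ ∙ e)ᗮ.orthogonalProjectionOnto x) < inner ℝ e x} := by
  intro η hη
  have hK : 0 < (K : ℝ) + 1 := by positivity
  have hδ : 0 < η / 2 / (2 * (K + 1)) := by positivity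
  -- A shift within `δ` of `(η / 2) • e` raises the height by at least `η / 2 - δ` and `g` by at
  -- most `K * δ`; the total loss `(K + 1) * δ = η / 4` is less than `η / 2`.
  have hδK : (K + 1) * (η / 2 / (2 * (K + 1))) = η / 4 := by field_simp; norm_num
  set δ := η / 2 / (2 * ((K : ℝ) + 1)) with hδdef
  have hKδ : 0 ≤ K * δ := by positivity
  refine ⟨(η / 2) • e, δ, hδ, fun w hw => ?_, fun w hw x hx => ?_⟩
  · rw [Metric.mem_ball, dist_eq_norm] at hw
    rw [mem_ball_zero_iff]
    have h1 : ‖(η / 2) • e‖ = η / 2 := by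
      rw [norm_smul, he, mul_one, Real.norm_of_nonneg (by positivity)]
    have h2 := norm_add_le (w - (η / 2) • e) ((η / 2) • e)
    rw [sub_add_cancel] at h2
    linarith
  · rw [Metric.mem_ball, dist_eq_norm] at hw
    set w' := w - (η / 2) • e with hw'
    have hw2 : w = (η / 2) • e + w' := by rw [hw']; abel
    have hpe : (ℝ ∙ e)ᗮ.orthogonalProjectionOnto e = 0 :=
      Submodule.orthogonalProjectionOnto_orthogonal_apply_eq_zero
        (Submodule.mem_span_singleton_self e)
    have hp : (ℝ ∙ e)ᗮ.orthogonalProjectionOnto (x + w) =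
        (ℝ ∙ e)ᗮ.orthogonalProjectionOnto x + (ℝ ∙ e)ᗮ.orthogonalProjectionOnto w' := by
      rw [hw2, map_add, map_add, map_smul, hpe, smul_zero, zero_add]
    have hi : inner ℝ e (x + w) = inner ℝ e x + η / 2 + inner ℝ e w' := by
      rw [hw2, inner_add_right, inner_add_right, inner_smul_right, real_inner_self_eq_norm_sq, he]
      ring
    have hiw : -δ ≤ inner ℝ e w' := by
      have := (abs_le.1 (abs_real_inner_le_norm e w')).1
      rw [he, one_mul] at this
      linarith
    have hgx : g ((ℝ ∙ e)ᗮ.orthogonalProjectionOnto (x + w)) ≤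
        g ((ℝ ∙ e)ᗮ.orthogonalProjectionOnto x) + K * δ := by
      have := hg.dist_le_mul ((ℝ ∙ e)ᗮ.orthogonalProjectionOnto (x + w))
        ((ℝ ∙ e)ᗮ.orthogonalProjectionOnto x)
      rw [Real.dist_eq, hp, dist_eq_norm, add_sub_cancel_left, ← hp] at this
      have h2 := (ℝ ∙ e)ᗮ.norm_orthogonalProjectionOnto_apply_le w'
      have h3 : (K : ℝ) * ‖(ℝ ∙ e)ᗮ.orthogonalProjectionOnto w'‖ ≤ K * δ := by
        gcongr; exact h2.trans hw.le
      linarith [(abs_le.1 this).2]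
    have hx' : g ((ℝ ∙ e)ᗮ.orthogonalProjectionOnto x) < inner ℝ e x := hx
    change g _ < _
    rw [hi]
    linarith

theorem HasLipschitzBoundary.exists_inward {Ω : Set (EuclideanSpace ℝ (Fin d))} (hΩ : IsOpen Ω)
    (hL : HasLipschitzBoundary Ω) {z : EuclideanSpace ℝ (Fin d)} (hz : z ∈ closure Ω) :
    ∃ r > (0 : ℝ), ∃ D : Set (EuclideanSpace ℝ (Fin d)),
      MeasurableSet D ∧ HasInwardShifts D ∧ Ω ∩ Metric.ball z r = D ∩ Metric.ball z r := by
  by_cases hzΩ : z ∈ Ω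
  · obtain ⟨r, hr, hsub⟩ := Metric.isOpen_iff.1 hΩ z hzΩ
    exact ⟨r, hr, Set.univ, MeasurableSet.univ, hasInwardShifts_univ, by
      rw [Set.inter_eq_right.2 hsub, Set.univ_inter]⟩
  · obtain ⟨r, hr, e, he, K, g, hg, h⟩ := hL z (by rw [hΩ.frontier_eq]; exact ⟨hz, hzΩ⟩)
    have hgc := hg.continuous
    refine ⟨r, hr, _, ?_, hasInwardShifts_epigraph he hg, ?_⟩
    · exact (isOpen_lt (by fun_prop) (by fun_prop)).measurableSet
    · ext x
      exact and_congr_left fun hx => h x hx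

theorem map_coe_domainMeasure {Ω : Set (EuclideanSpace ℝ (Fin d))} (hΩ : IsOpen Ω) :
    (domainMeasure Ω).map (↑) = (volume : Measure (EuclideanSpace ℝ (Fin d))).restrict Ω :=
  map_comap_subtype_coe hΩ.measurableSet volume

theorem lintegral_domainMeasure {Ω : Set (EuclideanSpace ℝ (Fin d))} (hΩ : IsOpen Ω)
    (f : EuclideanSpace ℝ (Fin d) → ℝ≥0∞) :
    ∫⁻ x, f x ∂(domainMeasure Ω) = ∫⁻ x in Ω, f x := by
  rw [← map_coe_domainMeasure hΩ,
    (MeasurableEmbedding.subtype_coe hΩ.measurableSet).lintegral_map]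

theorem lintegral_prod_domainMeasure {Ω : Set (EuclideanSpace ℝ (Fin d))} (hΩ : IsOpen Ω)
    (f : EuclideanSpace ℝ (Fin d) × EuclideanSpace ℝ (Fin d) → ℝ≥0∞) :
    ∫⁻ p, f (p.1, p.2) ∂((domainMeasure Ω).prod (domainMeasure Ω)) =
      ∫⁻ p, f p ∂((volume.restrict Ω).prod (volume.restrict Ω)) := by
  have he := MeasurableEmbedding.subtype_coe hΩ.measurableSet
  rw [← map_coe_domainMeasure hΩ, Measure.map_prod_map _ _ he.measurable he.measurable,
    (he.prodMap he).lintegral_map]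
  rfl

theorem densityProperty_domain {ν : EuclideanSpace ℝ (Fin d) → ℝ≥0}
    (hν : IsSymmetricLevyDensity ν) {Ω : Set (EuclideanSpace ℝ (Fin d))}
    (hΩ : IsOpen Ω) (hb : Bornology.IsBounded Ω) (hL : HasLipschitzBoundary Ω) :
    DensityProperty (domainMeasure Ω) (domainLevyKernel Ω ν) := by
  have hm := hν.measurable
  -- The domain kernel uses `ν (x - y)`, the energy `ν (y - x)`.
  have hsymm : ∀ x y, ν (x - y) = ν (y - x) := fun x y => by
    rcases eq_or_ne x y with rfl | hxy
    · rfl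
    · rw [hν.symm _ (sub_ne_zero.2 hxy), neg_sub]
  refine densityProperty_of_approx (domainMeasure Ω)
    (k := fun x y => ν ((x : EuclideanSpace ℝ (Fin d)) - y))
    (by unfold Function.uncurry; fun_prop) fun u M hu huM hE ε hε => ?_
  have he := MeasurableEmbedding.subtype_coe hΩ.measurableSet
  -- Extension by zero; the values off `Ω` do not enter the energy over `volume.restrict Ω`.
  set U : EuclideanSpace ℝ (Fin d) → ℝ := Function.extend (↑) u 0 with hUdef
  have hU : ∀ x : Ω, U x = u x := fun x => Subtype.coe_injective.extend_apply _ _ _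
  have hUm : Measurable U := he.measurable_extend hu measurable_const
  have hUM : ∀ x, |U x| ≤ M := fun x => by
    by_cases hx : x ∈ Ω
    · rw [hU ⟨x, hx⟩]; exact huM _
    · rw [hUdef, Function.extend_apply' _ _ _ (by rintro ⟨y, rfl⟩; exact hx y.2)]
      simp
  have henergy : ∀ f : EuclideanSpace ℝ (Fin d) → ℝ,
      ∫⁻ p, ‖graphGrad (fun x : Ω => f x) p‖ₑ ^ 2 *
        (ν ((p.1 : EuclideanSpace ℝ (Fin d)) - p.2) : ℝ≥0∞)
          ∂((domainMeasure Ω).prod (domainMeasure Ω)) =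
      levyEnergy ν (volume.restrict Ω) f := fun f => by
    rw [levyEnergy, ← lintegral_prod_domainMeasure hΩ]
    exact lintegral_congr fun p => by rw [hsymm]; rfl
  have hUE : levyEnergy ν (volume.restrict Ω) U < ∞ := by
    rw [← henergy]
    simpa only [hU] using hE
  obtain ⟨v, -, ⟨⟨K, hK⟩, C, hC⟩, h1, h2⟩ := lipschitzApproximable_of_locally_inward hν
    hΩ.measurableSet hb (fun z hz => hL.exists_inward hΩ hz) hUm hUM hUE ε hε
  refine ⟨fun x => v x, ⟨⟨K, fun x y => hK x y⟩, C, fun x => hC x⟩, ?_, ?_⟩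
  · rw [← lintegral_domainMeasure hΩ] at h1
    simpa only [hU] using h1
  · rw [← henergy] at h2
    have e : (fun x : Ω => (v - U) x) = (fun x : Ω => v x) - u := by ext x; simp [hU]
    rwa [e] at h2

end Reduction

end DensityProp

theorem mainTheorem12 {d : ℕ} (ν : EuclideanSpace ℝ (Fin d) → ℝ≥0)
    (hν : DensityProp.IsSymmetricLevyDensity ν) :
    (∀ γ : EuclideanSpace ℝ (Fin d) → ℝ,
      MemLp γ 1 volume → MemLp γ ∞ volume →
      (∀ (z : EuclideanSpace ℝ (Fin d)) (r : ℝ), ∃ c > (0 : ℝ),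
        ∀ᵐ x ∂volume, x ∈ Metric.ball z r → c ≤ γ x) →
      DensityProp.DensityProperty (DensityProp.weightedMeasure γ)
        (DensityProp.weightedLevyKernel γ ν)) ∧
    (∀ Ω : Set (EuclideanSpace ℝ (Fin d)),
      IsOpen Ω → Bornology.IsBounded Ω → DensityProp.HasLipschitzBoundary Ω →
      DensityProp.DensityProperty (DensityProp.domainMeasure Ω)
        (DensityProp.domainLevyKernel Ω ν)) :=
  ⟨fun _ h1 htop hloc => DensityProp.densityProperty_weighted hν h1 htop hloc,
    fun _ hΩ hb hL => DensityProp.densityProperty_domain hν hΩ hb hL⟩
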